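/- Let $d\in\mathbb N$, $D=d+2d^2$, $\varepsilon>0$, and let $h:\mathbb R\times\mathbb R^{2d}\to\mathbb R$ be such that for every $t$ the classical symbol $h(t,\cdot)$ is $C^\infty$ and each of its derivatives grows at most exponentially ($|\partial^{\mathbf k}h(t,z)|\le C\,e^{\beta\|z\|}$ with $C,\beta>0$ depending on $\mathbf k$ and $t$). Write points of $\mathbb R^{2D}$ as $\mathbf z=(\mathbf q,\mathbf p)$ with $$\mathbf q=\bigl(q,\sqrt{\varepsilon/2}\,\mathrm{vec}\,\mathrm{Re}\,Q,\sqrt{\varepsilon/2}\,\mathrm{vec}\,\mathrm{Im}\,Q\bigr),\qquad \mathbf p=\bigl(p,\sqrt{\varepsilon/2}\,\mathrm{vec}\,\mathrm{Re}\,P,\sqrt{\varepsilon/2}\,\mathrm{vec}\,\mathrm{Im}\,P\bigr),$$ where $q,p\in\mathbb R^d$ and $Q,P\in\mathbb C^{d\times d}$, put $z=(q,p)$, $Y=\begin{pmatrix}\mathrm{Re}\,Q&\mathrm{Im}\,Q\\ \mathrm{Re}\,P&\mathrm{Im}\,P\end{pmatrix}$, $Y_\varepsilon=\sqrt{\varepsilon/2}\,Y$,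 $\Omega_m=\begin{pmatrix}0&\mathrm{Id}_m\\-\mathrm{Id}_m&0\end{pmatrix}$, and define the averaged Hamiltonian $$\bar h(t,\mathbf z)=(2\pi)^{-d}\int_{\mathbb R^{2d}}h(t,Y_\varepsilon\zeta+z)\,e^{-\zeta^\top\zeta/2}\,d\zeta,\qquad \mathbf z\in\mathbb R^{2D}.$$ A time-dependent function $f$ is called subquadratic if for every multi-index $\mathbf k$ with $|\mathbf k|\ge2$ there is $C_{\mathbf k}\in L^1_{\mathrm{loc}}(\mathbb R)$ with $|\partial^{\mathbf k}f(t,z)|\le C_{\mathbf k}(t)$ for all $t,z$; a function $g$ is called coercive if $g(z)\to+\infty$ as $\|z\|\to\infty$. Then: 1. The integral defining $\bar h$ converges absolutely and $\bar h(t,\cdot)$ is $C^\infty$ on $\mathbb R^{2D}$. If $Y$ is symplectic, i.e. $Y^\top\Omega_dY=\Omega_d$, then $\bar h(t,\mathbf z)=\int_{\mathbb R^{2d}}h(t,\zeta)\,\mathcal W_u(\zeta)\,d\zeta$, where $u$ is the Gaussian wave packet $$u(x)=\frac{(\varepsilon\pi)^{-d/4}}{\det(Q)^{1/2}}\exp\Bigl(\tfrac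 i\varepsilon\bigl(\tfrac12(x-q)^\top PQ^{-1}(x-q)+p^\top(x-q)+S\bigr)\Bigr),\qquad S\in\mathbb R,$$ and $\mathcal W_u(x,\xi)=(2\pi\varepsilon)^{-d}\int_{\mathbb R^d}\overline{u(x+y/2)}\,u(x-y/2)\,e^{i\xi^\top y/\varepsilon}\,dy$ is its Wigner function. 2. For every $t$, if $h(t,\cdot)$ is coercive, then $\bar h(t,\cdot)$ is coercive. 3. If $h$ is subquadratic, then $\bar h$ is subquadratic. 4. If either (a) $h$ is subquadratic, $t\mapsto h(t,z)$ is measurable for all $z$ and $t\mapsto\nabla h(t,0)$ is locally integrable, or (b) $h$ is time-independent and coercive, then the variational equations of motion $\dot{\mathbf z}(t)=\Omega_D\nabla_{\mathbf z}\bar h(t,\mathbf z(t))$ are globally well-posed: for every initial time $s$ and initial value there is a solution on all of $\mathbb R$, every solution on any interval is a restriction of such a global solution, and the solution depends continuously on $t$, on $s$ and on the initial value jointly. Moreover, if $Y$ is symplectic at one time along a solution, then it is so at all times, so that the solution describes a Gaussian wave packet throughout. Here a solution on an interval $I$ is a function $\mathbf z$ for which $t\mapsto\Omega_D\nabla\bar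 h(t,\mathbf z(t))$ is integrable on compact subintervals of $I$ and $\mathbf z(t)-\mathbf z(s)=\int_s^t\Omega_D\nabla\bar h(\tau,\mathbf z(\tau))\,d\tau$ for all $s,t\in I$. -/

import Mathlib

open MeasureTheory Filter Topology
open scoped ContDiff

namespace GaussianWavePacket

noncomputable section

/-- Classical phase space `ℝ^{2d}`, points `(x, ξ)` (or `(q, p)`). -/
abbrev ClassicalPhase (d : ℕ) : Type := EuclideanSpace ℝ (Fin d ⊕ Fin d)

/-- Index set of size `D = d + 2 d²`: a vector of `ℝ^d`, followed by the entries of two real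
`d × d` matrices (the scaled real and imaginary parts). -/
abbrev ConfIdx (d : ℕ) : Type := Fin d ⊕ ((Fin d × Fin d) ⊕ (Fin d × Fin d))

/-- Parameter phase space `ℝ^{2D}` with canonical coordinates `(𝐪, 𝐩)`, where
`𝐪 = (q, √(ε/2) vec Re Q, √(ε/2) vec Im Q)` and `𝐩 = (p, √(ε/2) vec Re P, √(ε/2) vec Im P)`. -/
abbrev ParamPhase (d : ℕ) : Type := EuclideanSpace ℝ (ConfIdx d ⊕ ConfIdx d)

variable {d : ℕ}

/-- The position centre `q`. -/
def posCentre (Z : ParamPhase d) : EuclideanSpace ℝ (Fin d) :=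
  WithLp.toLp 2 fun j => Z (Sum.inl (Sum.inl j))

/-- The momentum centre `p`. -/
def momCentre (Z : ParamPhase d) : EuclideanSpace ℝ (Fin d) :=
  WithLp.toLp 2 fun j => Z (Sum.inr (Sum.inl j))

/-- The phase space centre `z = (q, p)`. -/
def centre (Z : ParamPhase d) : ClassicalPhase d :=
  WithLp.toLp 2 (Sum.elim (posCentre Z) (momCentre Z))

/-- The block `√(ε/2) Re Q`. -/
def reQ (Z : ParamPhase d) : Matrix (Fin d) (Fin d) ℝ :=
  Matrix.of fun j k => Z (Sum.inl (Sum.inr (Sum.inl (j, k))))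

/-- The block `√(ε/2) Im Q`. -/
def imQ (Z : ParamPhase d) : Matrix (Fin d) (Fin d) ℝ :=
  Matrix.of fun j k => Z (Sum.inl (Sum.inr (Sum.inr (j, k))))

/-- The block `√(ε/2) Re P`. -/
def reP (Z : ParamPhase d) : Matrix (Fin d) (Fin d) ℝ :=
  Matrix.of fun j k => Z (Sum.inr (Sum.inr (Sum.inl (j, k))))

/-- The block `√(ε/2) Im P`. -/
def imP (Z : ParamPhase d) : Matrix (Fin d) (Fin d) ℝ :=
  Matrix.of fun j k => Z (Sum.inr (Sum.inr (Sum.inr (j, k))))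

/-- The covariance factor `Y_ε = √(ε/2) (Re Q, Im Q; Re P, Im P)`. -/
def covFactor (Z : ParamPhase d) : Matrix (Fin d ⊕ Fin d) (Fin d ⊕ Fin d) ℝ :=
  Matrix.fromBlocks (reQ Z) (imQ Z) (reP Z) (imP Z)

/-- The structure matrix `Ω = (0, Id; -Id, 0)`. -/
def structureMatrix (ι : Type) [DecidableEq ι] : Matrix (ι ⊕ ι) (ι ⊕ ι) ℝ :=
  Matrix.fromBlocks 0 1 (-1) 0

/-- The integrand `a(Y_ε ζ + z) exp(-ζᵀζ/2)` of the Gaussian average. -/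
def averageIntegrand (a : ClassicalPhase d → ℝ) (Z : ParamPhase d) (ζ : ClassicalPhase d) : ℝ :=
  a (WithLp.toLp 2 ((covFactor Z).mulVec ζ) + centre Z) * Real.exp (-(1 / 2) * ‖ζ‖ ^ 2)

/-- The Gaussian average `⟨a⟩` as a function on all of `ℝ^{2D}`:
`(2π)^{-d} ∫ a(Y_ε ζ + z) exp(-ζᵀζ/2) dζ`. -/
def gaussianAverage (a : ClassicalPhase d → ℝ) (Z : ParamPhase d) : ℝ :=
  ((2 * Real.pi) ^ d)⁻¹ * ∫ ζ : ClassicalPhase d, averageIntegrand a Z ζ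

/-- The parameters describe a Gaussian wave packet: `Yᵀ Ω Y = Ω` for `Y = (ε/2)^{-1/2} Y_ε`. -/
def IsAdmissible (ε : ℝ) (Z : ParamPhase d) : Prop :=
  (covFactor Z).transpose * structureMatrix (Fin d) * covFactor Z
    = (ε / 2) • structureMatrix (Fin d)

/-- The complex matrix `Q`. -/
def matQ (ε : ℝ) (Z : ParamPhase d) : Matrix (Fin d) (Fin d) ℂ :=
  Matrix.of fun j k =>
    (((Real.sqrt (ε / 2))⁻¹ : ℝ) : ℂ) * ((reQ Z j k : ℂ) + Complex.I * (imQ Z j k : ℂ))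

/-- The complex matrix `P`. -/
def matP (ε : ℝ) (Z : ParamPhase d) : Matrix (Fin d) (Fin d) ℂ :=
  Matrix.of fun j k =>
    (((Real.sqrt (ε / 2))⁻¹ : ℝ) : ℂ) * ((reP Z j k : ℂ) + Complex.I * (imP Z j k : ℂ))

/-- The Gaussian wave packet `u` in Hagedorn's parametrization, with real phase `S`:
`(επ)^{-d/4} det(Q)^{-1/2} exp((i/ε) (½ (x-q)ᵀ P Q⁻¹ (x-q) + pᵀ (x-q) + S))`. -/
def wavePacket (ε S : ℝ) (Z : ParamPhase d) (x : EuclideanSpace ℝ (Fin d)) : ℂ :=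
  let w : Fin d → ℂ := fun j => ((x j - posCentre Z j : ℝ) : ℂ)
  let p : Fin d → ℂ := fun j => ((momCentre Z j : ℝ) : ℂ)
  (((ε * Real.pi) ^ (-(d : ℝ) / 4) : ℝ) : ℂ) / ((matQ ε Z).det ^ (1 / 2 : ℂ)) *
    Complex.exp (Complex.I / (ε : ℂ) *
      (1 / 2 * dotProduct w ((matP ε Z * (matQ ε Z)⁻¹).mulVec w) + dotProduct p w + (S : ℂ)))

/-- The (semiclassically scaled) Wigner function
`(2πε)^{-d} ∫ conj(ψ(x + y/2)) ψ(x - y/2) exp(i ξᵀy/ε) dy` of `ψ`. -/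
def wigner (ε : ℝ) (ψ : EuclideanSpace ℝ (Fin d) → ℂ) (ζ : ClassicalPhase d) : ℂ :=
  let x : EuclideanSpace ℝ (Fin d) := WithLp.toLp 2 fun j => ζ (Sum.inl j)
  let ξ : EuclideanSpace ℝ (Fin d) := WithLp.toLp 2 fun j => ζ (Sum.inr j)
  (((2 * Real.pi * ε) ^ d : ℝ) : ℂ)⁻¹ *
    ∫ y : EuclideanSpace ℝ (Fin d),
      (starRingEnd ℂ) (ψ (x + (1 / 2 : ℝ) • y)) * ψ (x - (1 / 2 : ℝ) • y) *
        Complex.exp (Complex.I * ((inner ℝ ξ y / ε : ℝ) : ℂ))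

/-- All derivatives of `a` grow at most exponentially. -/
def ExponentialGrowth (a : ClassicalPhase d → ℝ) : Prop :=
  ∀ n : ℕ, ∃ C β : ℝ, 0 < β ∧ ∀ z, ‖iteratedFDeriv ℝ n a z‖ ≤ C * Real.exp (β * ‖z‖)

/-- Subquadratic growth of a time-dependent function: every derivative of order at least two in
the space variable is bounded, uniformly in space, by a locally integrable function of time. -/
def Subquadratic {E : Type*} [NormedAddCommGroup E] [NormedSpace ℝ E] (f : ℝ → E → ℝ) : Prop :=
  ∀ n : ℕ, 2 ≤ n → ∃ C : ℝ → ℝ, LocallyIntegrable C volume ∧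
    ∀ t z, ‖iteratedFDeriv ℝ n (f t) z‖ ≤ C t

/-- Coercivity: `f(z) → +∞` as `‖z‖ → ∞`. -/
def Coercive {E : Type*} [NormedAddCommGroup E] (f : E → ℝ) : Prop :=
  Tendsto f (Bornology.cobounded E) atTop

/-- The Hamiltonian vector field `Ω_D ∇H`. -/
def hamiltonField (H : ParamPhase d → ℝ) (Z : ParamPhase d) : ParamPhase d :=
  WithLp.toLp 2 ((structureMatrix (ConfIdx d)).mulVec (gradient H Z).ofLp)

section ODE

variable {E : Type*} [NormedAddCommGroup E] [NormedSpace ℝ E]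

/-- `γ` solves `γ' = F(t, γ)` on the interval `I`, in integrated form. When `t ↦ F(t, γ(t))` is
continuous this is the classical notion; in general it is that of an absolutely continuous
solution. -/
def IsSolutionOn (F : ℝ → E → E) (I : Set ℝ) (γ : ℝ → E) : Prop :=
  ∀ s ∈ I, ∀ t ∈ I,
    IntervalIntegrable (fun τ => F τ (γ τ)) volume s t ∧ γ t - γ s = ∫ τ in s..t, F τ (γ τ)

/-- Global well-posedness of `γ' = F(t, γ)`: for every initial time `s` and initial value `z` there
is a solution `t ↦ Φ t s z` on all of `ℝ`, every solution on any interval agrees with it, and it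
depends continuously on `(t, s, z)`. -/
def GloballyWellPosed (F : ℝ → E → E) : Prop :=
  ∃ Φ : ℝ → ℝ → E → E,
    (∀ s z, Φ s s z = z ∧ IsSolutionOn F Set.univ fun t => Φ t s z) ∧
    (∀ (I : Set ℝ) (γ : ℝ → E), I.OrdConnected → IsSolutionOn F I γ →
      ∀ s ∈ I, ∀ t ∈ I, γ t = Φ t s (γ s)) ∧
    Continuous fun x : ℝ × ℝ × E => Φ x.1 x.2.1 x.2.2

end ODE

/-- Every solution that describes a Gaussian wave packet at one time of an interval does so at all
times of that interval. -/
def PreservesWavePackets (ε : ℝ) (F : ℝ → ParamPhase d → ParamPhase d) : Prop :=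
  ∀ (I : Set ℝ) (γ : ℝ → ParamPhase d), I.OrdConnected → IsSolutionOn F I γ →
    ∀ s ∈ I, IsAdmissible ε (γ s) → ∀ t ∈ I, IsAdmissible ε (γ t)

end

end GaussianWavePacket

/-! Smoothness and growth. For fixed `ζ` the point `Y_ε ζ + z` is a linear function of the
parameters `Z` (`argMap`), of norm at most a constant times `1 + ‖ζ‖`. An `n`-th derivative of the
integrand in `Z` therefore costs a factor `(1 + ‖ζ‖) ^ n`, which the Gaussian absorbs together with
any exponential. This justifies differentiating under the integral to all orders, and it passes
uniform derivative bounds of the symbol on to its average, with a constant that depends only on `d`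
and `n`.

Coercivity. Along an unbounded sequence of parameters, a subsequence of the directions `Z n / ‖Z n‖`
converges to some `W ≠ 0`. As a nonzero affine function of `ζ`, `argMap ζ W` vanishes only on a null
set, so the symbol at `argMap ζ (Z n)` tends to infinity for almost every `ζ`. The symbol is bounded
below, and Fatou's lemma concludes.

Well-posedness. In the subquadratic case the field is Lipschitz in space with a locally integrable
constant `l`; in the sup norm weighted by `exp (2 |∫ l|)` the Picard operator is a contraction on
the whole time axis at once. In the coercive case the averaged Hamiltonian is a coercive conserved
quantity, so that on each sublevel set the equation agrees with one cut off to compact support,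
which is globally Lipschitz.

Conservation. Solutions are only absolutely continuous, so constancy of a `C²` function along them
is drawn from increments that are quadratic in arc length (`eq_of_abs_sub_le_sq`). Gaussian
integration by parts shows that `(∂H/∂Y)ᵀ Y` is symmetric for an average `H`
(`sum_covDeriv_mul_comm`), which is precisely the vanishing of the derivative of `Yᵀ Ω Y` along the
flow.

Wigner function. Symplecticity of `Y` says that `Qᵀ P = Pᵀ Q` and `Qᴴ P - Pᴴ Q = 2i`. Hence `P Q⁻¹ =
A + i Sᵀ S` with `A` real symmetric, `S` real and `S Q` unitary. A Gaussian integral then shows that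
the Wigner function at `Y_ε ζ + z` is `(πε)^{-d} exp(-‖ζ‖²/2)`, and an affine change of variables
identifies the two averages. -/

open MeasureTheory Filter Topology
open scoped ContDiff BoundedContinuousFunction

namespace GaussianWavePacket

/-! ### Differentiation of parametric integrals to all orders -/

section ParametricIntegral

variable {α E F : Type*} [MeasurableSpace α] {μ : Measure α}
  [NormedAddCommGroup E] [NormedSpace ℝ E] [NormedAddCommGroup F] [NormedSpace ℝ F]

/-- Differentiation under the integral sign, for a derivative that factors through a continuous
linear map. -/
theorem hasFDerivAt_integral_comp_clm {X : Type*} [NormedAddCommGroup X] [NormedSpace ℝ X]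
    [CompleteSpace X] (c : X →L[ℝ] E →L[ℝ] F) [CompleteSpace F] {f : E → α → F} {f' : E → α → X}
    {x : E} {s : Set E} {b : α → ℝ} (hs : s ∈ 𝓝 x)
    (hmeas : ∀ y, AEStronglyMeasurable (f y) μ) (hint : Integrable (f x) μ)
    (hint' : Integrable (f' x) μ) (hb : Integrable b μ)
    (hle : ∀ a, ∀ y ∈ s, ‖c (f' y a)‖ ≤ b a)
    (hd : ∀ a, ∀ y ∈ s, HasFDerivAt (fun y => f y a) (c (f' y a)) y) :
    HasFDerivAt (fun y => ∫ a, f y a ∂μ) (c (∫ a, f' x a ∂μ)) x := by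
  rw [← c.integral_comp_comm hint']
  exact hasFDerivAt_integral_of_dominated_of_fderiv_le (F' := fun y a => c (f' y a)) hs
    (Eventually.of_forall hmeas) hint (c.continuous.comp_aestronglyMeasurable hint'.1)
    (Eventually.of_forall hle) hb (Eventually.of_forall hd)

/-- Differentiation under the integral sign to all orders. -/
theorem hasFTaylorSeriesUpTo_integral [CompleteSpace F] {f : E → α → F}
    (hf : ∀ a, ContDiff ℝ ∞ fun x => f x a)
    (hmeas : ∀ (n : ℕ) (x : E), AEStronglyMeasurable (fun a => iteratedFDeriv ℝ n (fun y => f y a) x) μ)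
    (hbound : ∀ (n : ℕ) (x : E), ∃ s ∈ 𝓝 x, ∃ b : α → ℝ, Integrable b μ ∧
      ∀ a, ∀ y ∈ s, ‖iteratedFDeriv ℝ n (fun y => f y a) y‖ ≤ b a) :
    HasFTaylorSeriesUpTo ∞ (fun x => ∫ a, f x a ∂μ)
      (fun x n => ∫ a, iteratedFDeriv ℝ n (fun y => f y a) x ∂μ) := by
  have hint : ∀ (n : ℕ) (x : E), Integrable (fun a => iteratedFDeriv ℝ n (fun y => f y a) x) μ := by
    intro n x
    obtain ⟨s, hs, b, hb, hle⟩ := hbound n x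
    exact hb.mono' (hmeas n x) (Eventually.of_forall fun a => hle a x (mem_of_mem_nhds hs))
  refine (hasFTaylorSeriesUpTo_top_iff' le_rfl).2 ⟨fun x => ?_, fun n x => ?_⟩
  · have h0 := (continuousMultilinearCurryFin0 ℝ E F).toContinuousLinearEquiv.toContinuousLinearMap.integral_comp_comm (hint 0 x)
    refine Eq.trans h0.symm ?_
    refine integral_congr_ae (Eventually.of_forall fun a => ?_)
    simp
  · obtain ⟨s, hs, b, hb, hle⟩ := hbound (n + 1) x
    have hd : ∀ a y, HasFDerivAt (fun y => iteratedFDeriv ℝ n (fun y => f y a) y)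
        (iteratedFDeriv ℝ (n + 1) (fun y => f y a) y).curryLeft y := by
      intro a y
      have h1 := (contDiff_iff_ftaylorSeries.1 (hf a)).fderiv n (by exact_mod_cast WithTop.coe_lt_top n) y
      exact h1
    -- Currying the derivative of order `n + 1` gives the derivative of that of order `n`. Currying
    -- is a linear isometry, so it commutes with the integral and preserves the bound.
    refine hasFDerivAt_integral_comp_clm
      (continuousMultilinearCurryLeftEquiv ℝ
        (fun _ : Fin (n + 1) => E) F).toContinuousLinearEquiv.toContinuousLinearMap
      hs (hmeas n) (hint n x) (hint (n + 1) x) hb (fun a y hy => ?_) (fun a y _ => hd a y)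
    exact (ContinuousMultilinearMap.curryLeft_norm _).trans_le (hle a y hy)

end ParametricIntegral

end GaussianWavePacket

namespace GaussianWavePacket

/-! ### Moments of the Gaussian -/

section Moments

variable {V : Type*} [NormedAddCommGroup V] [InnerProductSpace ℝ V] [FiniteDimensional ℝ V]
  [MeasurableSpace V] [BorelSpace V]

theorem integrable_exp_neg_mul_sq_norm {b : ℝ} (hb : 0 < b) :
    Integrable fun v : V => Real.exp (-b * ‖v‖ ^ 2) := by
  have h := (GaussianFourier.integrable_cexp_neg_mul_sq_norm_add (b := (b : ℂ)) (by simpa using hb)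
    0 (0 : V)).norm
  refine h.congr (Eventually.of_forall fun v => ?_)
  simp only [Complex.norm_exp]
  congr 1
  simp [← Complex.ofReal_pow]

/-- A Gaussian has moments of all polynomial and exponential orders. -/
theorem integrable_pow_mul_exp_mul_gaussian (n : ℕ) (b : ℝ) :
    Integrable fun v : V =>
      (1 + ‖v‖) ^ n * Real.exp (b * ‖v‖) * Real.exp (-(1 / 2) * ‖v‖ ^ 2) := by
  -- With `(1 + r) ^ n ≤ n! exp (1 + r)` the exponent becomes `1 + (b + 1) r - r²/2`; completing the
  -- square bounds `(b + 1) r` by `(b + 1)² + r²/4`, which leaves half of the Gaussian decay.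
  have h := (integrable_exp_neg_mul_sq_norm (V := V) (b := 1 / 4) (by norm_num)).const_mul
    (n.factorial * Real.exp (1 + (b + 1) ^ 2))
  refine h.mono' (by fun_prop) (Eventually.of_forall fun v => ?_)
  rw [Real.norm_of_nonneg (by positivity)]
  have h1 : (1 + ‖v‖) ^ n ≤ n.factorial * Real.exp (1 + ‖v‖) := by
    have := Real.pow_div_factorial_le_exp (1 + ‖v‖) (by positivity) n
    rwa [div_le_iff₀ (by positivity), mul_comm] at this
  calc (1 + ‖v‖) ^ n * Real.exp (b * ‖v‖) * Real.exp (-(1 / 2) * ‖v‖ ^ 2)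
      ≤ n.factorial * Real.exp (1 + ‖v‖) * Real.exp (b * ‖v‖) * Real.exp (-(1 / 2) * ‖v‖ ^ 2) := by
        gcongr
    _ = n.factorial * Real.exp ((1 + ‖v‖) + b * ‖v‖ + -(1 / 2) * ‖v‖ ^ 2) := by
        rw [Real.exp_add (1 + ‖v‖ + b * ‖v‖), Real.exp_add (1 + ‖v‖)]; ring
    _ ≤ n.factorial * Real.exp ((1 + (b + 1) ^ 2) + -(1 / 4) * ‖v‖ ^ 2) := by
        refine mul_le_mul_of_nonneg_left (Real.exp_le_exp.2 ?_) (by positivity)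
        nlinarith [sq_nonneg (‖v‖ / 2 - (b + 1))]
    _ = _ := by rw [Real.exp_add]; ring

end Moments

/-! ### Smoothness of the average and bounds for its derivatives -/

variable {d : ℕ}

/-- The bilinear map `(ζ, Z) ↦ Y_ε ζ`. -/
noncomputable def covMap : ClassicalPhase d →L[ℝ] ParamPhase d →L[ℝ] ClassicalPhase d :=
  LinearMap.toContinuousBilinearMap (LinearMap.mk₂ ℝ
    (fun (ζ : ClassicalPhase d) (Z : ParamPhase d) =>
      (WithLp.toLp 2 ((covFactor Z).mulVec ζ) : ClassicalPhase d))
    (fun ζ η Z => by simp [Matrix.mulVec_add])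
    (fun c ζ Z => by simp [Matrix.mulVec_smul])
    (fun ζ Z W => by
      ext i
      rcases i with i | i <;>
      simp [covFactor, reQ, imQ, reP, imP, Matrix.mulVec, dotProduct, add_mul,
        Finset.sum_add_distrib] <;> ring)
    (fun c ζ Z => by
      ext i
      rcases i with i | i <;>
      simp [covFactor, reQ, imQ, reP, imP, Matrix.mulVec, dotProduct, mul_assoc,
        Finset.mul_sum, mul_add]))

/-- The linear map `Z ↦ z`. -/
noncomputable def centreMap : ParamPhase d →L[ℝ] ClassicalPhase d :=
  LinearMap.toContinuousLinearMap
    { toFun := centre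
      map_add' := fun Z W => by
        ext i
        rcases i with i | i <;> simp [centre, posCentre, momCentre]
      map_smul' := fun c Z => by
        ext i
        rcases i with i | i <;> simp [centre, posCentre, momCentre] }

/-- The linear map `Z ↦ Y_ε ζ + z`. -/
noncomputable def argMap (ζ : ClassicalPhase d) : ParamPhase d →L[ℝ] ClassicalPhase d :=
  covMap ζ + centreMap

theorem covMap_apply (ζ : ClassicalPhase d) (Z : ParamPhase d) :
    covMap ζ Z = WithLp.toLp 2 ((covFactor Z).mulVec ζ) := rfl

theorem argMap_apply (ζ : ClassicalPhase d) (Z : ParamPhase d) :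
    argMap ζ Z = WithLp.toLp 2 ((covFactor Z).mulVec ζ) + centre Z := rfl

@[fun_prop]
theorem continuous_argMap : Continuous (argMap : ClassicalPhase d → _) :=
  (covMap (d := d)).continuous.add continuous_const

variable (d) in
/-- A bound for the norm of `argMap`. -/
noncomputable def argBound : ℝ := ‖covMap (d := d)‖ + ‖centreMap (d := d)‖

theorem argBound_nonneg : 0 ≤ argBound d := by unfold argBound; positivity

theorem norm_argMap_le (ζ : ClassicalPhase d) : ‖argMap ζ‖ ≤ argBound d * (1 + ‖ζ‖) := by
  refine (norm_add_le _ _).trans ?_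
  have := (covMap (d := d)).le_opNorm ζ
  have h1 := norm_nonneg (covMap (d := d))
  have h2 := norm_nonneg (centreMap (d := d))
  have h3 := norm_nonneg ζ
  unfold argBound
  nlinarith [mul_nonneg h2 h3]

theorem averageIntegrand_eq (a : ClassicalPhase d → ℝ) (Z : ParamPhase d) (ζ : ClassicalPhase d) :
    averageIntegrand a Z ζ = Real.exp (-(1 / 2) * ‖ζ‖ ^ 2) • (a ∘ argMap ζ) Z :=
  mul_comm _ _

/-- Because `argMap ζ` is linear, the chain rule produces a single term, with `n` copies of `argMap
ζ` inserted into the `n`-th derivative of `a`. -/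
theorem iteratedFDeriv_averageIntegrand {a : ClassicalPhase d → ℝ} (ha : ContDiff ℝ ∞ a) (n : ℕ)
    (Z : ParamPhase d) (ζ : ClassicalPhase d) :
    iteratedFDeriv ℝ n (fun Z => averageIntegrand a Z ζ) Z =
      Real.exp (-(1 / 2) * ‖ζ‖ ^ 2) •
        (iteratedFDeriv ℝ n a (argMap ζ Z)).compContinuousLinearMap fun _ => argMap ζ := by
  have hn : (n : ℕ∞ω) ≤ ∞ := by exact_mod_cast (WithTop.coe_lt_top n).le
  simp only [averageIntegrand_eq]
  rw [iteratedFDeriv_const_smul_apply' ((ha.of_le hn).comp (argMap ζ).contDiff).contDiffAt,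
    (argMap ζ).iteratedFDeriv_comp_right ha Z hn]

theorem contDiff_averageIntegrand {a : ClassicalPhase d → ℝ} (ha : ContDiff ℝ ∞ a)
    (ζ : ClassicalPhase d) : ContDiff ℝ ∞ fun Z => averageIntegrand a Z ζ := by
  simp only [averageIntegrand_eq]
  exact (ha.comp (argMap ζ).contDiff).const_smul _

theorem norm_iteratedFDeriv_averageIntegrand_le {a : ClassicalPhase d → ℝ} (ha : ContDiff ℝ ∞ a)
    (n : ℕ) (Z : ParamPhase d) (ζ : ClassicalPhase d) :
    ‖iteratedFDeriv ℝ n (fun Z => averageIntegrand a Z ζ) Z‖ ≤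
      ‖iteratedFDeriv ℝ n a (argMap ζ Z)‖ *
        (argBound d ^ n * ((1 + ‖ζ‖) ^ n * Real.exp (-(1 / 2) * ‖ζ‖ ^ 2))) := by
  rw [iteratedFDeriv_averageIntegrand ha, norm_smul, Real.norm_of_nonneg (Real.exp_pos _).le]
  have h1 := (iteratedFDeriv ℝ n a (argMap ζ Z)).norm_compContinuousLinearMap_le
    fun _ => argMap ζ
  rw [Finset.prod_const, Finset.card_univ, Fintype.card_fin] at h1
  have h2 : ‖argMap ζ‖ ^ n ≤ (argBound d * (1 + ‖ζ‖)) ^ n := by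
    gcongr; exact norm_argMap_le ζ
  rw [mul_pow] at h2
  calc _ ≤ Real.exp (-(1 / 2) * ‖ζ‖ ^ 2) * (‖iteratedFDeriv ℝ n a (argMap ζ Z)‖ *
        (argBound d ^ n * (1 + ‖ζ‖) ^ n)) := by gcongr; exact h1.trans (by gcongr)
    _ = _ := by ring

theorem continuous_iteratedFDeriv_averageIntegrand {a : ClassicalPhase d → ℝ}
    (ha : ContDiff ℝ ∞ a) (n : ℕ) (Z : ParamPhase d) :
    Continuous fun ζ => iteratedFDeriv ℝ n (fun Z => averageIntegrand a Z ζ) Z := by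
  simp only [iteratedFDeriv_averageIntegrand ha]
  have hn : (n : ℕ∞ω) ≤ ∞ := by exact_mod_cast (WithTop.coe_lt_top n).le
  have h1 : Continuous fun ζ : ClassicalPhase d => iteratedFDeriv ℝ n a (argMap ζ Z) :=
    (ha.continuous_iteratedFDeriv hn).comp (by fun_prop)
  -- Composition with linear maps is continuous and multilinear in these maps, so it inherits the
  -- continuity of `ζ ↦ argMap ζ`.
  have h2 : Continuous fun ζ : ClassicalPhase d =>
      ContinuousMultilinearMap.compContinuousLinearMapContinuousMultilinear ℝ
        (fun _ : Fin n => ParamPhase d) (fun _ : Fin n => ClassicalPhase d) ℝ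
        (fun _ => argMap ζ) :=
    (ContinuousMultilinearMap.cont _).comp (continuous_pi fun _ => continuous_argMap)
  exact (by fun_prop : Continuous fun ζ : ClassicalPhase d =>
    Real.exp (-(1 / 2) * ‖ζ‖ ^ 2)).smul (h2.clm_apply h1)

theorem averageIntegrand_bound {a : ClassicalPhase d → ℝ} (ha : ContDiff ℝ ∞ a)
    (hexp : ExponentialGrowth a) (n : ℕ) (Z : ParamPhase d) :
    ∃ s ∈ 𝓝 Z, ∃ b : ClassicalPhase d → ℝ, Integrable b ∧
      ∀ ζ, ∀ W ∈ s, ‖iteratedFDeriv ℝ n (fun Z => averageIntegrand a Z ζ) W‖ ≤ b ζ := by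
  obtain ⟨C, β, hβ, hC⟩ := hexp n
  have hC0 : 0 ≤ C := by
    have := (norm_nonneg _).trans (hC 0)
    simpa using this
  set K := argBound d
  have hK : 0 ≤ K := argBound_nonneg
  -- For `W` within distance `1` of `Z`, `β ‖argMap ζ W‖ ≤ R (1 + ‖ζ‖)`, so the growth of `a` is at
  -- most `exp R * exp (R ‖ζ‖)` uniformly on the ball.
  set R := β * (K * (‖Z‖ + 1))
  refine ⟨Metric.ball Z 1, Metric.ball_mem_nhds Z one_pos, fun ζ => C * Real.exp R * K ^ n *
    ((1 + ‖ζ‖) ^ n * Real.exp (R * ‖ζ‖) * Real.exp (-(1 / 2) * ‖ζ‖ ^ 2)),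
    (integrable_pow_mul_exp_mul_gaussian n R).const_mul _, fun ζ W hW => ?_⟩
  refine (norm_iteratedFDeriv_averageIntegrand_le ha n W ζ).trans ?_
  have hWn : ‖W‖ ≤ ‖Z‖ + 1 := by
    have h1 : ‖W - Z‖ < 1 := by simpa [dist_eq_norm] using hW
    linarith [norm_sub_norm_le W Z]
  have h1 : ‖argMap ζ W‖ ≤ K * (1 + ‖ζ‖) * (‖Z‖ + 1) :=
    ((argMap ζ).le_opNorm W).trans (by gcongr; exact norm_argMap_le ζ)
  have h2 : ‖iteratedFDeriv ℝ n a (argMap ζ W)‖ ≤ C * (Real.exp R * Real.exp (R * ‖ζ‖)) := by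
    refine (hC _).trans ?_
    rw [← Real.exp_add]
    gcongr
    calc β * ‖argMap ζ W‖ ≤ β * (K * (1 + ‖ζ‖) * (‖Z‖ + 1)) := by gcongr
      _ = _ := by simp only [R]; ring
  calc _ ≤ C * (Real.exp R * Real.exp (R * ‖ζ‖)) *
        (K ^ n * ((1 + ‖ζ‖) ^ n * Real.exp (-(1 / 2) * ‖ζ‖ ^ 2))) := by gcongr
    _ = _ := by ring

theorem integrable_iteratedFDeriv_averageIntegrand {a : ClassicalPhase d → ℝ}
    (ha : ContDiff ℝ ∞ a) (hexp : ExponentialGrowth a) (n : ℕ) (Z : ParamPhase d) :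
    Integrable fun ζ => iteratedFDeriv ℝ n (fun Z => averageIntegrand a Z ζ) Z := by
  obtain ⟨s, hs, b, hb, hle⟩ := averageIntegrand_bound ha hexp n Z
  exact hb.mono' (continuous_iteratedFDeriv_averageIntegrand ha n Z).aestronglyMeasurable
    (Eventually.of_forall fun ζ => hle ζ Z (mem_of_mem_nhds hs))

theorem integrable_averageIntegrand {a : ClassicalPhase d → ℝ}
    (ha : ContDiff ℝ ∞ a) (hexp : ExponentialGrowth a) (Z : ParamPhase d) :
    Integrable (averageIntegrand a Z) := by
  have h := (integrable_iteratedFDeriv_averageIntegrand ha hexp 0 Z).norm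
  refine h.mono' ?_ (Eventually.of_forall fun ζ => ?_)
  · have : Continuous (averageIntegrand a Z) := by
      have h1 : averageIntegrand a Z =
          fun ζ => Real.exp (-(1 / 2) * ‖ζ‖ ^ 2) • a (argMap ζ Z) :=
        funext fun ζ => averageIntegrand_eq a Z ζ
      have h2 := ha.continuous
      rw [h1]
      fun_prop
    exact this.aestronglyMeasurable
  · rw [norm_iteratedFDeriv_zero]

theorem hasFTaylorSeriesUpTo_integral_averageIntegrand {a : ClassicalPhase d → ℝ}
    (ha : ContDiff ℝ ∞ a) (hexp : ExponentialGrowth a) :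
    HasFTaylorSeriesUpTo ∞ (fun Z => ∫ ζ, averageIntegrand a Z ζ)
      (fun Z n => ∫ ζ, iteratedFDeriv ℝ n (fun Z => averageIntegrand a Z ζ) Z) :=
  hasFTaylorSeriesUpTo_integral (contDiff_averageIntegrand ha)
    (fun n Z => (continuous_iteratedFDeriv_averageIntegrand ha n Z).aestronglyMeasurable)
    (averageIntegrand_bound ha hexp)

theorem contDiff_gaussianAverage {a : ClassicalPhase d → ℝ}
    (ha : ContDiff ℝ ∞ a) (hexp : ExponentialGrowth a) :
    ContDiff ℝ ∞ (gaussianAverage a) :=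
  contDiff_const.mul (hasFTaylorSeriesUpTo_integral_averageIntegrand ha hexp).contDiff

theorem iteratedFDeriv_gaussianAverage {a : ClassicalPhase d → ℝ}
    (ha : ContDiff ℝ ∞ a) (hexp : ExponentialGrowth a) (n : ℕ) (Z : ParamPhase d) :
    iteratedFDeriv ℝ n (gaussianAverage a) Z = ((2 * Real.pi) ^ d)⁻¹ •
      ∫ ζ, iteratedFDeriv ℝ n (fun Z => averageIntegrand a Z ζ) Z := by
  have hT := hasFTaylorSeriesUpTo_integral_averageIntegrand ha hexp
  have hn : (n : ℕ∞ω) ≤ ∞ := by exact_mod_cast (WithTop.coe_lt_top n).le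
  have h1 : gaussianAverage a =
      fun Z => ((2 * Real.pi) ^ d)⁻¹ • ∫ ζ, averageIntegrand a Z ζ := rfl
  rw [h1, iteratedFDeriv_const_smul_apply' (hT.contDiff.of_le hn).contDiffAt]
  congr 1
  exact (hT.eq_iteratedFDeriv hn Z).symm

variable (d) in
/-- The constant by which Gaussian averaging multiplies bounds of derivatives of order `n`. -/
noncomputable def averageConst (n : ℕ) : ℝ := ((2 * Real.pi) ^ d)⁻¹ *
  ∫ ζ : ClassicalPhase d, argBound d ^ n * ((1 + ‖ζ‖) ^ n * Real.exp (-(1 / 2) * ‖ζ‖ ^ 2))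

theorem averageConst_nonneg (n : ℕ) : 0 ≤ averageConst d n := by
  have := argBound_nonneg (d := d)
  exact mul_nonneg (by positivity) (integral_nonneg fun ζ => by positivity)

/-- The constant does not involve `a` or `Z`, so time-dependent bounds keep their local
integrability. The bound on `a` is needed only at the points `argMap ζ Z`; for `Z = 0` this is the
origin alone. -/
theorem norm_iteratedFDeriv_gaussianAverage_le {a : ClassicalPhase d → ℝ}
    (ha : ContDiff ℝ ∞ a) (hexp : ExponentialGrowth a) (n : ℕ) (Z : ParamPhase d) {C : ℝ}
    (hC : ∀ ζ, ‖iteratedFDeriv ℝ n a (argMap ζ Z)‖ ≤ C) :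
    ‖iteratedFDeriv ℝ n (gaussianAverage a) Z‖ ≤ C * averageConst d n := by
  have hK := argBound_nonneg (d := d)
  rw [iteratedFDeriv_gaussianAverage ha hexp, norm_smul, Real.norm_of_nonneg (by positivity),
    averageConst, mul_left_comm]
  gcongr
  rw [← integral_const_mul]
  have hint := (integrable_pow_mul_exp_mul_gaussian (V := ClassicalPhase d) n 0).const_mul
    (argBound d ^ n)
  simp only [zero_mul, Real.exp_zero, mul_one] at hint
  refine norm_integral_le_of_norm_le (hint.const_mul C) (Eventually.of_forall fun ζ => ?_)
  refine (norm_iteratedFDeriv_averageIntegrand_le ha n Z ζ).trans ?_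
  gcongr
  exact hC ζ

theorem subquadratic_gaussianAverage {h : ℝ → ClassicalPhase d → ℝ}
    (hsmooth : ∀ t, ContDiff ℝ ∞ (h t)) (hexp : ∀ t, ExponentialGrowth (h t))
    (hsub : Subquadratic h) : Subquadratic fun t => gaussianAverage (h t) := by
  intro n hn
  obtain ⟨C, hC, hle⟩ := hsub n hn
  refine ⟨averageConst d n • C, hC.smul _, fun t Z => ?_⟩
  rw [Pi.smul_apply, smul_eq_mul, mul_comm]
  exact norm_iteratedFDeriv_gaussianAverage_le (hsmooth t) (hexp t) n Z fun ζ => hle t _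

theorem integrable_fderiv_argMap {a : ClassicalPhase d → ℝ}
    (ha : ContDiff ℝ ∞ a) (hexp : ExponentialGrowth a) (Z W : ParamPhase d) :
    Integrable fun ζ => Real.exp (-(1 / 2) * ‖ζ‖ ^ 2) * fderiv ℝ a (argMap ζ Z) (argMap ζ W) := by
  have hint := integrable_iteratedFDeriv_averageIntegrand ha hexp 1 Z
  have := (ContinuousMultilinearMap.apply ℝ (fun _ : Fin 1 => ParamPhase d) ℝ
    (fun _ => W)).integrable_comp hint
  refine this.congr (Eventually.of_forall fun ζ => ?_)
  simp [iteratedFDeriv_averageIntegrand ha, iteratedFDeriv_one_apply]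

theorem fderiv_gaussianAverage {a : ClassicalPhase d → ℝ}
    (ha : ContDiff ℝ ∞ a) (hexp : ExponentialGrowth a) (Z W : ParamPhase d) :
    fderiv ℝ (gaussianAverage a) Z W = ((2 * Real.pi) ^ d)⁻¹ *
      ∫ ζ, Real.exp (-(1 / 2) * ‖ζ‖ ^ 2) * fderiv ℝ a (argMap ζ Z) (argMap ζ W) := by
  have h1 : fderiv ℝ (gaussianAverage a) Z W =
      iteratedFDeriv ℝ 1 (gaussianAverage a) Z fun _ => W := by
    rw [iteratedFDeriv_one_apply]
  have hint := integrable_iteratedFDeriv_averageIntegrand ha hexp 1 Z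
  rw [h1, iteratedFDeriv_gaussianAverage ha hexp, smul_apply,
    ContinuousMultilinearMap.integral_apply hint, smul_eq_mul]
  congr 2 with ζ
  simp [iteratedFDeriv_averageIntegrand ha, iteratedFDeriv_one_apply]

end GaussianWavePacket

namespace GaussianWavePacket

/-! ### Coercivity of the average -/

variable {d : ℕ}

/-- For fixed `W`, `ζ ↦ Y_ε ζ + z` is affine; this is the form in which the closure axiom of
`AffineSubspace` asks for it. -/
theorem argMap_affine (W : ParamPhase d) (c : ℝ) (ζ η θ : ClassicalPhase d) :
    argMap (c • (ζ - η) + θ) W = c • (argMap ζ W - argMap η W) + argMap θ W := by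
  simp only [argMap, map_add, map_smul, map_sub, add_apply,
    smul_apply, sub_apply, smul_sub, smul_add]
  abel

theorem eq_zero_of_argMap_eq_zero {W : ParamPhase d} (h : ∀ ζ, argMap ζ W = 0) : W = 0 := by
  have hc : centre W = 0 := by simpa [argMap_apply] using h 0
  have hY : covFactor W = 0 := by
    refine Matrix.mulVec_injective (funext fun v => ?_)
    have := h (WithLp.toLp 2 v)
    rw [argMap_apply, hc, add_zero] at this
    simpa using congrArg WithLp.ofLp this
  ext i
  rcases i with (j | (⟨j, k⟩ | ⟨j, k⟩)) | (j | (⟨j, k⟩ | ⟨j, k⟩))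
  · simpa [centre, posCentre] using congrArg (fun v : ClassicalPhase d => v (Sum.inl j)) hc
  · simpa [covFactor, reQ] using congrFun₂ hY (Sum.inl j) (Sum.inl k)
  · simpa [covFactor, imQ] using congrFun₂ hY (Sum.inl j) (Sum.inr k)
  · simpa [centre, momCentre] using congrArg (fun v : ClassicalPhase d => v (Sum.inr j)) hc
  · simpa [covFactor, reP] using congrFun₂ hY (Sum.inr j) (Sum.inl k)
  · simpa [covFactor, imP] using congrFun₂ hY (Sum.inr j) (Sum.inr k)

/-- The zero set is an affine subspace. It is proper, since an affine map that vanishes identically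
has zero linear part and zero constant, hence `W = 0`; proper affine subspaces are null sets. -/
theorem ae_argMap_ne_zero {W : ParamPhase d} (hW : W ≠ 0) : ∀ᵐ ζ, argMap ζ W ≠ 0 := by
  let S : AffineSubspace ℝ (ClassicalPhase d) :=
    { carrier := {ζ | argMap ζ W = 0}
      smul_vsub_vadd_mem' := fun c ζ η θ h1 h2 h3 => by
        change argMap (c • (ζ - η) + θ) W = 0
        rw [argMap_affine, show argMap ζ W = 0 from h1, show argMap η W = 0 from h2,
          show argMap θ W = 0 from h3]
        simp }
  have hS : S ≠ ⊤ := fun h => hW (eq_zero_of_argMap_eq_zero fun ζ => by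
    have : ζ ∈ S := h ▸ AffineSubspace.mem_top ℝ _ ζ
    exact this)
  have := Measure.addHaar_affineSubspace volume S hS
  rw [ae_iff]
  simp only [ne_eq, not_not]
  exact this

/-- By linearity `‖argMap ζ (Z n)‖` is `‖Z n‖` times the norm at the normalised parameter, and the
second factor has a positive limit. -/
theorem tendsto_norm_argMap {Z : ℕ → ParamPhase d} {W : ParamPhase d}
    (hZ : Tendsto (fun n => ‖Z n‖) atTop atTop)
    (hW : Tendsto (fun n => ‖Z n‖⁻¹ • Z n) atTop (𝓝 W)) {ζ : ClassicalPhase d}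
    (hζ : argMap ζ W ≠ 0) : Tendsto (fun n => argMap ζ (Z n)) atTop (Bornology.cobounded _) := by
  rw [← tendsto_norm_atTop_iff_cobounded]
  have h1 : Tendsto (fun n => ‖argMap ζ (‖Z n‖⁻¹ • Z n)‖) atTop (𝓝 ‖argMap ζ W‖) :=
    (((argMap ζ).continuous.tendsto W).comp hW).norm
  refine (hZ.atTop_mul_pos (norm_pos_iff.2 hζ) h1).congr' ?_
  filter_upwards [hZ.eventually_gt_atTop 0] with n hn
  rw [map_smul, norm_smul, norm_inv, norm_norm, mul_inv_cancel_left₀ hn.ne']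

/-- A continuous coercive `a` attains its minimum; after subtracting it, the integrands are
nonnegative and tend to infinity almost everywhere, so that Fatou's lemma applies. -/
theorem tendsto_gaussianAverage_seq {a : ClassicalPhase d → ℝ}
    (ha : ContDiff ℝ ∞ a) (hexp : ExponentialGrowth a) (hco : Coercive a)
    {Z : ℕ → ParamPhase d} {W : ParamPhase d} (hW0 : W ≠ 0)
    (hZ : Tendsto (fun n => ‖Z n‖) atTop atTop)
    (hW : Tendsto (fun n => ‖Z n‖⁻¹ • Z n) atTop (𝓝 W)) :
    Tendsto (fun n => gaussianAverage a (Z n)) atTop atTop := by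
  obtain ⟨x₀, hx₀⟩ := ha.continuous.exists_forall_le (by
    rw [← Metric.cobounded_eq_cocompact]; exact hco)
  set w : ClassicalPhase d → ℝ := fun ζ => Real.exp (-(1 / 2) * ‖ζ‖ ^ 2)
  have hw : Integrable w := integrable_exp_neg_mul_sq_norm (by norm_num)
  have hac := ha.continuous
  set g : ℕ → ClassicalPhase d → ℝ := fun n ζ => w ζ * (a (argMap ζ (Z n)) - a x₀)
  have hgc : ∀ n, Continuous (g n) := fun n => by simp only [g, w]; fun_prop
  have hg0 : ∀ n ζ, 0 ≤ g n ζ := fun n ζ =>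
    mul_nonneg (Real.exp_pos _).le (sub_nonneg.2 (hx₀ _))
  have hgeq : ∀ n, g n = fun ζ => averageIntegrand a (Z n) ζ - a x₀ * w ζ := fun n => by
    ext ζ; simp only [averageIntegrand_eq, g, w, Function.comp, smul_eq_mul]; ring
  have hgi : ∀ n, Integrable (g n) := fun n => by
    rw [hgeq]; exact (integrable_averageIntegrand ha hexp _).sub (hw.const_mul _)
  have hlim : ∀ᵐ ζ : ClassicalPhase d, liminf (fun n => ENNReal.ofReal (g n ζ)) atTop = ⊤ := by
    filter_upwards [ae_argMap_ne_zero hW0] with ζ hζ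
    refine Tendsto.liminf_eq (ENNReal.tendsto_ofReal_nhds_top.2 ?_)
    exact (tendsto_atTop_add_const_right _ (-a x₀)
      (hco.comp (tendsto_norm_argMap hZ hW hζ))).const_mul_atTop (Real.exp_pos _)
  have hfatou := lintegral_liminf_le (μ := (volume : Measure (ClassicalPhase d)))
    (u := atTop) (f := fun n ζ => ENNReal.ofReal (g n ζ)) fun n => (hgc n).measurable.ennreal_ofReal
  rw [lintegral_congr_ae hlim, lintegral_const, ENNReal.top_mul (NeZero.ne _)] at hfatou
  have htop : Tendsto (fun n => ENNReal.ofReal (∫ ζ, g n ζ)) atTop (𝓝 ⊤) := by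
    simp only [ofReal_integral_eq_lintegral_ofReal (hgi _) (Eventually.of_forall (hg0 _))]
    exact tendsto_of_le_liminf_of_limsup_le (f := atTop) hfatou le_top (by isBoundedDefault)
      (by isBoundedDefault)
  have h1 := ENNReal.tendsto_ofReal_nhds_top.1 htop
  have h2 := (tendsto_atTop_add_const_right _ (∫ ζ, a x₀ * w ζ) h1).const_mul_atTop
    (show 0 < ((2 * Real.pi) ^ d)⁻¹ by positivity)
  refine h2.congr fun n => ?_
  rw [hgeq n, integral_sub (integrable_averageIntegrand ha hexp _) (hw.const_mul _),
    sub_add_cancel]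
  rfl

/-- It suffices to treat a subsequence of each unbounded sequence, and compactness lets the
normalised parameters converge along one; the limit has norm `1` and is therefore nonzero. -/
theorem coercive_gaussianAverage {a : ClassicalPhase d → ℝ}
    (ha : ContDiff ℝ ∞ a) (hexp : ExponentialGrowth a) (hco : Coercive a) :
    Coercive (gaussianAverage a) := by
  have : (Bornology.cobounded (ParamPhase d)).IsCountablyGenerated := by
    rw [← comap_norm_atTop]; infer_instance
  refine tendsto_of_subseq_tendsto fun Z hZ => ?_
  have hZn : Tendsto (fun n => ‖Z n‖) atTop atTop := tendsto_norm_atTop_iff_cobounded.2 hZ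
  have hmem : ∀ n, ‖Z n‖⁻¹ • Z n ∈ Metric.closedBall (0 : ParamPhase d) 1 := fun n => by
    rw [mem_closedBall_zero_iff, norm_smul, norm_inv, norm_norm]
    exact inv_mul_le_one
  obtain ⟨W, -, φ, hφ, hlim⟩ := (isCompact_closedBall (0 : ParamPhase d) 1).tendsto_subseq hmem
  have hZφ := hZn.comp hφ.tendsto_atTop
  refine ⟨φ, tendsto_gaussianAverage_seq ha hexp hco (W := W) ?_ hZφ hlim⟩
  have h1 : Tendsto (fun n => ‖(‖Z (φ n)‖⁻¹ • Z (φ n))‖) atTop (𝓝 1) := by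
    refine tendsto_const_nhds.congr' ?_
    filter_upwards [hZφ.eventually_gt_atTop 0] with n hn
    rw [norm_smul, norm_inv, norm_norm]
    exact (inv_mul_cancel₀ hn.ne').symm
  have h2 := tendsto_nhds_unique h1 hlim.norm
  intro h0
  simp [h0] at h2

end GaussianWavePacket

/-! ### Conservation laws along absolutely continuous curves -/

namespace GaussianWavePacket

/-- A function whose increments are bounded by the squared increments of a continuous function
is constant. -/
theorem eq_of_abs_sub_le_sq {φ Λ : ℝ → ℝ} {K s t : ℝ} (hst : s ≤ t)
    (hΛ : ContinuousOn Λ (Set.Icc s t)) (hm : MonotoneOn Λ (Set.Icc s t))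
    (h : ∀ u v, s ≤ u → u ≤ v → v ≤ t → |φ v - φ u| ≤ K * (Λ v - Λ u) ^ 2) : φ t = φ s := by
  have key : ∀ n : ℕ, ∀ u v, s ≤ u → u ≤ v → v ≤ t →
      |φ v - φ u| ≤ K * (Λ v - Λ u) ^ 2 / 2 ^ n := by
    intro n
    induction n with
    | zero => intro u v h1 h2 h3; simpa using h u v h1 h2 h3
    | succ n ih =>
      intro u v h1 h2 h3
      have hmuv : Λ u ≤ Λ v := hm ⟨h1, h2.trans h3⟩ ⟨h1.trans h2, h3⟩ h2
      -- Split where `Λ`, not time, is halved: two squares of half the increment sum to half the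
      -- square, so each subdivision gains a factor `2`.
      obtain ⟨m, ⟨hm1, hm2⟩, hm3⟩ := intermediate_value_Icc h2
        (hΛ.mono (Set.Icc_subset_Icc h1 h3))
        (show (Λ u + Λ v) / 2 ∈ Set.Icc (Λ u) (Λ v) from ⟨by linarith, by linarith⟩)
      have e1 := ih u m h1 hm1 (hm2.trans h3)
      have e2 := ih m v (h1.trans hm1) hm2 h3
      rw [hm3] at e1 e2
      calc |φ v - φ u| ≤ |φ v - φ m| + |φ m - φ u| := abs_sub_le _ _ _
        _ ≤ K * (Λ v - (Λ u + Λ v) / 2) ^ 2 / 2 ^ n + K * ((Λ u + Λ v) / 2 - Λ u) ^ 2 / 2 ^ n :=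
          add_le_add e2 e1
        _ = K * (Λ v - Λ u) ^ 2 / 2 ^ (n + 1) := by rw [pow_succ]; field_simp; ring
  have hlim : Tendsto (fun n : ℕ => K * (Λ t - Λ s) ^ 2 / 2 ^ n) atTop (𝓝 0) := by
    have := (tendsto_pow_atTop_nhds_zero_of_lt_one (r := (1 / 2 : ℝ)) (by norm_num)
      (by norm_num)).const_mul (K * (Λ t - Λ s) ^ 2)
    simpa [div_eq_mul_inv] using this
  have h0 : |φ t - φ s| ≤ 0 :=
    ge_of_tendsto' hlim fun n => key n s t le_rfl hst le_rfl
  exact sub_eq_zero.1 (abs_nonpos_iff.1 h0)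

section Conservation

variable {E : Type*} [NormedAddCommGroup E] [NormedSpace ℝ E] [FiniteDimensional ℝ E]

/-- A `C²` function whose derivative annihilates the velocity is constant along an absolutely
continuous curve. -/
theorem eq_of_fderiv_eq_zero {f γ : ℝ → E} {s t : ℝ} (hst : s ≤ t)
    (hf : IntervalIntegrable f volume s t)
    (hγ : ∀ u ∈ Set.Icc s t, ∀ v ∈ Set.Icc s t, γ v - γ u = ∫ τ in u..v, f τ)
    {g : E → ℝ} (hg : ContDiff ℝ 2 g)
    (h : ∀ τ ∈ Set.Icc s t, fderiv ℝ g (γ τ) (f τ) = 0) : g (γ t) = g (γ s) := by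
  have hsub : ∀ {u v}, u ∈ Set.Icc s t → v ∈ Set.Icc s t → IntervalIntegrable f volume u v :=
    fun hu hv => hf.mono_set (by
      rw [Set.uIcc_of_le hst]; exact Set.uIcc_subset_Icc hu hv)
  -- `Λ` is arc length: it is continuous and monotone, and it controls the increments of `γ`.
  set Λ : ℝ → ℝ := fun x => ∫ τ in s..x, ‖f τ‖
  have hs : s ∈ Set.Icc s t := ⟨le_rfl, hst⟩
  have hΛsub : ∀ {u v}, u ∈ Set.Icc s t → v ∈ Set.Icc s t → Λ v - Λ u = ∫ τ in u..v, ‖f τ‖ :=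
    fun hu hv => intervalIntegral.integral_interval_sub_left (hsub hs hv).norm (hsub hs hu).norm
  have hΛm : MonotoneOn Λ (Set.Icc s t) := fun u hu v hv huv => by
    rw [← sub_nonneg, hΛsub hu hv]
    exact intervalIntegral.integral_nonneg huv fun _ _ => norm_nonneg _
  have hΛc : ContinuousOn Λ (Set.Icc s t) := by
    have := intervalIntegral.continuousOn_primitive_interval (μ := volume) (f := fun τ => ‖f τ‖)
      (a := s) (b := t) ((intervalIntegrable_iff_integrableOn_Icc_of_le hst).1 hf.norm |>.mono_set
        (by rw [Set.uIcc_of_le hst]))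
    rwa [Set.uIcc_of_le hst] at this
  have hγle : ∀ {u v}, u ∈ Set.Icc s t → v ∈ Set.Icc s t → u ≤ v → ‖γ v - γ u‖ ≤ Λ v - Λ u :=
    fun hu hv huv => by
      rw [hγ _ hu _ hv, hΛsub hu hv]
      exact intervalIntegral.norm_integral_le_integral_norm huv
  set R := ‖γ s‖ + (Λ t - Λ s)
  have hball : ∀ {u}, u ∈ Set.Icc s t → γ u ∈ Metric.closedBall (0 : E) R := fun {u} hu => by
    rw [mem_closedBall_zero_iff]
    have h1 := hγle hs hu hu.1
    have h2 := hΛm hu ⟨hst, le_rfl⟩ hu.2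
    have h3 := norm_sub_norm_le (γ u) (γ s)
    simp only [R]; linarith
  have hDg : ContDiff ℝ 1 (fderiv ℝ g) := hg.fderiv_right (by norm_num)
  obtain ⟨K, hK⟩ := hDg.contDiffOn.exists_lipschitzOnWith one_ne_zero
    (convex_closedBall (0 : E) R) (isCompact_closedBall 0 R)
  -- One `K` comes from the Taylor remainder of `g` at `γ u` (`e1`), the other from the linear term
  -- (`e2`).
  refine eq_of_abs_sub_le_sq (φ := fun x => g (γ x)) (Λ := Λ) (K := 2 * K) hst hΛc hΛm
    fun u v h1 h2 h3 => ?_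
  have hu : u ∈ Set.Icc s t := ⟨h1, h2.trans h3⟩
  have hv : v ∈ Set.Icc s t := ⟨h1.trans h2, h3⟩
  set δ := Λ v - Λ u
  have hδ : 0 ≤ δ := sub_nonneg.2 (hΛm hu hv h2)
  have e1 : ‖g (γ v) - g (γ u) - fderiv ℝ g (γ u) (γ v - γ u)‖ ≤ K * δ * δ := by
    have hseg : segment ℝ (γ u) (γ v) ⊆ Metric.closedBall (0 : E) R :=
      (convex_closedBall (0 : E) R).segment_subset (hball hu) (hball hv)
    have := (convex_segment (γ u) (γ v)).norm_image_sub_le_of_norm_hasFDerivWithin_le'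
      (f := g) (f' := fderiv ℝ g) (φ := fderiv ℝ g (γ u)) (C := K * δ)
      (fun x _ => ((hg.differentiable (by norm_num)) x).hasFDerivAt.hasFDerivWithinAt)
      (fun x hx => by
        refine (hK.norm_sub_le (hseg hx) (hball hu)).trans ?_
        gcongr
        exact (norm_sub_le_of_mem_segment hx).trans (hγle hu hv h2))
      (left_mem_segment ℝ _ _) (right_mem_segment ℝ _ _)
    refine this.trans ?_
    gcongr
    exact hγle hu hv h2
  -- The linear term is the integral of `Dg(γ u) (f τ)`. Since `Dg(γ τ) (f τ) = 0`, `Dg(γ u)` may be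
  -- replaced by `Dg(γ u) - Dg(γ τ)`, which is of size `K δ`.
  have e2 : ‖fderiv ℝ g (γ u) (γ v - γ u)‖ ≤ K * δ * δ := by
    rw [hγ u hu v hv, ← (fderiv ℝ g (γ u)).intervalIntegral_comp_comm (hsub hu hv)]
    have e3 : K * δ * δ = ∫ τ in u..v, K * δ * ‖f τ‖ := by
      rw [intervalIntegral.integral_const_mul, ← hΛsub hu hv]
    rw [e3]
    refine intervalIntegral.norm_integral_le_of_norm_le h2 (Eventually.of_forall fun τ hτ => ?_)
      ((hsub hu hv).norm.const_mul _)
    have hτ' : τ ∈ Set.Icc s t := ⟨h1.trans hτ.1.le, hτ.2.trans h3⟩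
    rw [← sub_zero (fderiv ℝ g (γ u) (f τ)), ← h τ hτ', ← sub_apply]
    refine ((fderiv ℝ g (γ u) - fderiv ℝ g (γ τ)).le_opNorm _).trans ?_
    gcongr
    rw [norm_sub_rev]
    refine (hK.norm_sub_le (hball hτ') (hball hu)).trans ?_
    gcongr
    refine (hγle hu hτ' hτ.1.le).trans ?_
    simp only [δ]
    linarith [hΛm hτ' hv hτ.2]
  have e4 := abs_add_le (g (γ v) - g (γ u) - fderiv ℝ g (γ u) (γ v - γ u))
    (fderiv ℝ g (γ u) (γ v - γ u))
  rw [sub_add_cancel] at e4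
  rw [Real.norm_eq_abs] at e1 e2
  calc _ ≤ _ := e4
    _ ≤ 2 * K * δ ^ 2 := by linarith

/-- Conservation laws for solutions in integrated form. -/
theorem IsSolutionOn.conserved {F : ℝ → E → E} {I : Set ℝ} {γ : ℝ → E} (hI : I.OrdConnected)
    (hγ : IsSolutionOn F I γ) {g : E → ℝ} (hg : ContDiff ℝ 2 g)
    (h : ∀ t z, fderiv ℝ g z (F t z) = 0) {s t : ℝ} (hs : s ∈ I) (ht : t ∈ I) :
    g (γ t) = g (γ s) := by
  have key : ∀ {s t}, s ∈ I → t ∈ I → s ≤ t → g (γ t) = g (γ s) := fun {s t} hs ht hst =>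
    eq_of_fderiv_eq_zero hst (hγ s hs t ht).1
      (fun u hu v hv => (hγ u (hI.out hs ht hu) v (hI.out hs ht hv)).2) hg fun τ _ => h τ _
  rcases le_total s t with hst | hst
  · exact key hs ht hst
  · exact (key ht hs hst).symm

end Conservation

/-! ### Exponential weights and Gronwall's inequality -/

section Weight

variable {l : ℝ → ℝ}

theorem _root_.MeasureTheory.LocallyIntegrable.intervalIntegrable_of_real {G : Type*}
    [NormedAddCommGroup G] {f : ℝ → G} (hf : LocallyIntegrable f) (a b : ℝ) :
    IntervalIntegrable f volume a b :=
  (hf.integrableOn_isCompact isCompact_uIcc).intervalIntegrable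

/-- The primitive `P` of `l` is only absolutely continuous, so the classical chain rule is not
available. Instead, `z.2 - exp (c z.1) / c` is conserved along the curve `(P, ∫ l exp (c P))`. -/
theorem integral_mul_exp_primitive (hl : LocallyIntegrable l) {c : ℝ} (hc : c ≠ 0) (s t : ℝ) :
    ∫ τ in s..t, l τ * Real.exp (c * ∫ x in (0 : ℝ)..τ, l x) =
      (Real.exp (c * ∫ x in (0 : ℝ)..t, l x) - Real.exp (c * ∫ x in (0 : ℝ)..s, l x)) / c := by
  have hli := hl.intervalIntegrable_of_real
  set P : ℝ → ℝ := fun t => ∫ x in (0 : ℝ)..t, l x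
  have hP : Continuous P := intervalIntegral.continuous_primitive hli 0
  set m : ℝ → ℝ := fun τ => l τ * Real.exp (c * P τ)
  have hm : ∀ a b, IntervalIntegrable m volume a b := fun a b =>
    (hli a b).mul_continuousOn (by fun_prop)
  have hsol : IsSolutionOn (fun τ (z : ℝ × ℝ) => (l τ, l τ * Real.exp (c * z.1))) Set.univ
      (fun t => (P t, ∫ x in (0 : ℝ)..t, m x)) := by
    intro s _ t _
    have hi : IntervalIntegrable (fun τ => (l τ, m τ)) volume s t :=
      ⟨(hli s t).1.prodMk (hm s t).1, (hli s t).2.prodMk (hm s t).2⟩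
    refine ⟨hi, ?_⟩
    ext
    · have := (ContinuousLinearMap.fst ℝ ℝ ℝ).intervalIntegral_comp_comm hi
      simp only [ContinuousLinearMap.coe_fst'] at this
      exact (intervalIntegral.integral_interval_sub_left (hli _ _) (hli _ _)).trans this
    · have := (ContinuousLinearMap.snd ℝ ℝ ℝ).intervalIntegral_comp_comm hi
      simp only [ContinuousLinearMap.coe_snd'] at this
      exact (intervalIntegral.integral_interval_sub_left (hm _ _) (hm _ _)).trans this
  have hg : ContDiff ℝ 2 fun z : ℝ × ℝ => z.2 - c⁻¹ * Real.exp (c * z.1) := by fun_prop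
  have hcons := hsol.conserved Set.ordConnected_univ hg (fun τ z => by
    have hd : HasFDerivAt (fun z : ℝ × ℝ => z.2 - c⁻¹ * Real.exp (c * z.1))
        (ContinuousLinearMap.snd ℝ ℝ ℝ - c⁻¹ • (Real.exp (c * z.1) •
          (c • ContinuousLinearMap.fst ℝ ℝ ℝ))) z :=
      hasFDerivAt_snd.sub (((hasFDerivAt_fst.const_mul c).exp).const_mul c⁻¹)
    rw [hd.fderiv]
    simp only [sub_apply, smul_apply, ContinuousLinearMap.coe_snd', ContinuousLinearMap.coe_fst',
      smul_eq_mul]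
    field_simp
    ring) (Set.mem_univ s) (Set.mem_univ t)
  have h1 := intervalIntegral.integral_interval_sub_left (hm 0 t) (hm 0 s)
  rw [← h1, div_eq_inv_mul]
  simp only at hcons
  linarith

variable (l) in
/-- The exponential weight `exp (2 |∫ₛᵗ l|)`. -/
noncomputable def expWeight (s t : ℝ) : ℝ := Real.exp (2 * |∫ x in s..t, l x|)

theorem one_le_expWeight (s t : ℝ) : 1 ≤ expWeight l s t :=
  Real.one_le_exp (by positivity)

theorem expWeight_pos (s t : ℝ) : 0 < expWeight l s t := Real.exp_pos _

theorem continuous_expWeight (hl : LocallyIntegrable l) :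
    Continuous fun x : ℝ × ℝ => expWeight l x.1 x.2 := by
  have hli := hl.intervalIntegrable_of_real
  have hP : Continuous fun t => ∫ x in (0 : ℝ)..t, l x :=
    intervalIntegral.continuous_primitive hli 0
  have h : ∀ s t, ∫ x in s..t, l x = (∫ x in (0 : ℝ)..t, l x) - ∫ x in (0 : ℝ)..s, l x :=
    fun s t => (intervalIntegral.integral_interval_sub_left (hli _ _) (hli _ _)).symm
  have h2 : (fun x : ℝ × ℝ => expWeight l x.1 x.2) = fun x : ℝ × ℝ =>
      Real.exp (2 * |(∫ y in (0 : ℝ)..x.2, l y) - ∫ y in (0 : ℝ)..x.1, l y|) :=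
    funext fun x => by rw [expWeight, h]
  rw [h2]
  exact Real.continuous_exp.comp (continuous_const.mul
    (((hP.comp continuous_snd).sub (hP.comp continuous_fst)).abs))

theorem continuous_expWeight_right (hl : LocallyIntegrable l) (s : ℝ) :
    Continuous (expWeight l s) :=
  (continuous_expWeight hl).comp (by fun_prop : Continuous fun t : ℝ => (s, t))

theorem intervalIntegrable_mul_expWeight (hl : LocallyIntegrable l) (s a b : ℝ) :
    IntervalIntegrable (fun τ => l τ * expWeight l s τ) volume a b :=
  (hl.intervalIntegrable_of_real a b).mul_continuousOn
    (continuous_expWeight_right hl s).continuousOn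

/-- The `2` in the exponent of the weight turns into the factor `1/2`, which is later the
contraction constant of the Picard operator. -/
theorem abs_integral_mul_expWeight_le (hl : LocallyIntegrable l) (hl0 : ∀ t, 0 ≤ l t) (s t : ℝ) :
    |∫ τ in s..t, l τ * expWeight l s τ| ≤ expWeight l s t / 2 := by
  have hli := hl.intervalIntegrable_of_real
  set P : ℝ → ℝ := fun t => ∫ x in (0 : ℝ)..t, l x
  have hP : ∀ s t, ∫ x in s..t, l x = P t - P s :=
    fun s t => (intervalIntegral.integral_interval_sub_left (hli _ _) (hli _ _)).symm
  have hmono : ∀ {u v}, u ≤ v → P u ≤ P v := fun {u v} huv => by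
    rw [← sub_nonneg, ← hP]; exact intervalIntegral.integral_nonneg huv fun _ _ => hl0 _
  -- Between `s` and `t` the integral of `l ≥ 0` from `s` has a fixed sign, so the weight is a plain
  -- exponential, with `c = 2` forwards and `c = -2` backwards in time.
  have key : ∀ c : ℝ, c ≠ 0 → (∀ τ ∈ Set.uIcc s t, expWeight l s τ = Real.exp (c * (P τ - P s))) →
      ∫ τ in s..t, l τ * expWeight l s τ = (expWeight l s t - 1) / c := by
    intro c hc h
    have h1 : ∫ τ in s..t, l τ * expWeight l s τ =
        ∫ τ in s..t, Real.exp (-(c * P s)) * (l τ * Real.exp (c * P τ)) := by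
      refine intervalIntegral.integral_congr fun τ hτ => ?_
      simp only [h τ hτ]
      rw [mul_left_comm, ← Real.exp_add]
      ring_nf
    rw [h1, intervalIntegral.integral_const_mul, integral_mul_exp_primitive hl hc,
      h t Set.right_mem_uIcc, mul_div_assoc', mul_sub, ← Real.exp_add, ← Real.exp_add]
    change (Real.exp (-(c * P s) + c * P t) - Real.exp (-(c * P s) + c * P s)) / c = _
    rw [neg_add_cancel, Real.exp_zero]
    ring_nf
  have h1 := one_le_expWeight (l := l) s t
  rcases le_total s t with hst | hst
  · rw [key 2 two_ne_zero, abs_of_nonneg (by linarith)]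
    · linarith
    · intro τ hτ
      rw [Set.uIcc_of_le hst] at hτ
      rw [expWeight, hP, abs_of_nonneg (sub_nonneg.2 (hmono hτ.1))]
  · rw [key (-2) (by norm_num), abs_of_nonpos]
    · linarith
    · rw [div_neg]; linarith
    · intro τ hτ
      rw [Set.uIcc_of_ge hst] at hτ
      rw [expWeight, hP, abs_of_nonpos (sub_nonpos.2 (hmono hτ.2))]
      ring_nf

/-- Let `M` be the maximum of `δ` divided by the weight `w`. At a maximiser the hypothesis gives `M
w ≤ c + M w / 2`, and `w ≥ 1` yields `M ≤ 2 c`. -/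
theorem le_expWeight_of_le_integral (hl : LocallyIntegrable l) (hl0 : ∀ t, 0 ≤ l t) {s t c : ℝ}
    {δ : ℝ → ℝ} (hδ : ContinuousOn δ (Set.uIcc s t)) (hδ0 : ∀ x, 0 ≤ δ x)
    (h : ∀ x ∈ Set.uIcc s t, δ x ≤ c + |∫ τ in s..x, l τ * δ τ|) :
    δ t ≤ 2 * c * expWeight l s t := by
  have hwc := continuous_expWeight_right hl s
  obtain ⟨x₀, hx₀, hmax⟩ := isCompact_uIcc.exists_isMaxOn (Set.nonempty_uIcc (a := s) (b := t))
    (hδ.div hwc.continuousOn fun x _ => (expWeight_pos s x).ne')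
  set M := δ x₀ / expWeight l s x₀
  have hM0 : 0 ≤ M := div_nonneg (hδ0 _) (expWeight_pos _ _).le
  have hM : ∀ x ∈ Set.uIcc s t, δ x ≤ M * expWeight l s x := fun x hx =>
    (div_le_iff₀ (expWeight_pos _ _)).1 (hmax hx)
  have hint : |∫ τ in s..x₀, l τ * δ τ| ≤ M * (expWeight l s x₀ / 2) := by
    have hsub : Set.uIcc s x₀ ⊆ Set.uIcc s t := Set.uIcc_subset_uIcc Set.left_mem_uIcc hx₀
    calc |∫ τ in s..x₀, l τ * δ τ| ≤ |∫ τ in s..x₀, M * (l τ * expWeight l s τ)| := by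
          refine intervalIntegral.norm_integral_le_abs_of_norm_le (f := fun τ => l τ * δ τ)
            (ae_restrict_of_forall_mem measurableSet_uIoc fun τ hτ => ?_)
            ((intervalIntegrable_mul_expWeight hl s _ _).const_mul M)
          rw [Real.norm_of_nonneg (mul_nonneg (hl0 _) (hδ0 _)), mul_left_comm]
          exact mul_le_mul_of_nonneg_left (hM τ (hsub (Set.uIoc_subset_uIcc hτ))) (hl0 _)
      _ = M * |∫ τ in s..x₀, l τ * expWeight l s τ| := by
          rw [intervalIntegral.integral_const_mul, abs_mul, abs_of_nonneg hM0]
      _ ≤ _ := by gcongr; exact abs_integral_mul_expWeight_le hl hl0 s x₀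
  have h1 := h x₀ hx₀
  have h2 : δ x₀ = M * expWeight l s x₀ := (div_mul_cancel₀ _ (expWeight_pos _ _).ne').symm
  have h3 := one_le_expWeight (l := l) s x₀
  have h4 : M ≤ 2 * c := by nlinarith
  exact (hM t Set.right_mem_uIcc).trans (by gcongr; exact (expWeight_pos _ _).le)

end Weight

end GaussianWavePacket

namespace GaussianWavePacket

/-! ### Global well-posedness of Lipschitz Carathéodory equations -/

section Caratheodory

variable {E : Type*} [NormedAddCommGroup E]

/-- A Carathéodory vector field with a locally integrable bound `l` for its Lipschitz constants and
its values at the origin. -/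
structure IsLipschitzField (F : ℝ → E → E) (l : ℝ → ℝ) : Prop where
  locallyIntegrable : LocallyIntegrable l
  nonneg : ∀ t, 0 ≤ l t
  norm_zero_le : ∀ t, ‖F t 0‖ ≤ l t
  norm_sub_le : ∀ t x y, ‖F t x - F t y‖ ≤ l t * ‖x - y‖
  aestronglyMeasurable : ∀ γ : ℝ → E, Continuous γ → AEStronglyMeasurable fun τ => F τ (γ τ)

variable {F : ℝ → E → E} {l : ℝ → ℝ}

theorem IsLipschitzField.norm_le (hF : IsLipschitzField F l) (t : ℝ) (x : E) : ‖F t x‖ ≤ l t * (1 + ‖x‖) := by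
  have h1 := hF.norm_sub_le t x 0
  have h2 := hF.norm_zero_le t
  rw [sub_zero] at h1
  calc ‖F t x‖ ≤ ‖F t x - F t 0‖ + ‖F t 0‖ := by
        simpa using norm_add_le (F t x - F t 0) (F t 0)
    _ ≤ _ := by linarith

theorem IsLipschitzField.intervalIntegrable (hF : IsLipschitzField F l) {γ : ℝ → E} (hγ : Continuous γ) (s t : ℝ) :
    IntervalIntegrable (fun τ => F τ (γ τ)) volume s t := by
  have h1 : IntervalIntegrable (fun τ => l τ * (1 + ‖γ τ‖)) volume s t :=
    (hF.locallyIntegrable.intervalIntegrable_of_real s t).mul_continuousOn (by fun_prop)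
  exact h1.mono_fun (hF.aestronglyMeasurable γ hγ).restrict (Eventually.of_forall fun τ =>
    (hF.norm_le τ _).trans (le_abs_self _))

variable [NormedSpace ℝ E]

theorem IsSolutionOn.mono {I J : Set ℝ} {γ : ℝ → E} (h : IsSolutionOn F I γ) (hJ : J ⊆ I) :
    IsSolutionOn F J γ := fun s hs t ht => h s (hJ hs) t (hJ ht)

theorem IsSolutionOn.congr {G : ℝ → E → E} {I : Set ℝ} {γ : ℝ → E} (hI : I.OrdConnected)
    (h : IsSolutionOn F I γ) (hFG : ∀ t ∈ I, F t (γ t) = G t (γ t)) : IsSolutionOn G I γ := by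
  intro s hs t ht
  obtain ⟨h1, h2⟩ := h s hs t ht
  have h3 : ∀ τ ∈ Set.uIcc s t, F τ (γ τ) = G τ (γ τ) := fun τ hτ =>
    hFG τ (hI.uIcc_subset hs ht hτ)
  refine ⟨h1.congr fun τ hτ => h3 τ (Set.uIoc_subset_uIcc hτ), ?_⟩
  rw [h2]
  exact intervalIntegral.integral_congr h3

theorem IsSolutionOn.continuousOn_uIcc {γ : ℝ → E} {s t : ℝ}
    (h : IsSolutionOn F (Set.uIcc s t) γ) : ContinuousOn γ (Set.uIcc s t) := by
  have h1 := (h s Set.left_mem_uIcc t Set.right_mem_uIcc).1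
  have h2 : ContinuousOn (fun x => γ s + ∫ τ in s..x, F τ (γ τ)) (Set.uIcc s t) :=
    continuousOn_const.add
      (intervalIntegral.continuousOn_primitive_interval ((intervalIntegrable_iff' (by simp)).1 h1))
  refine h2.congr fun x hx => ?_
  simp only [← (h s Set.left_mem_uIcc x hx).2]
  abel

namespace IsLipschitzField

/-- Gronwall's estimate for the distance of two solutions. -/
theorem norm_sub_le_of_isSolutionOn (hF : IsLipschitzField F l) {I : Set ℝ} (hI : I.OrdConnected)
    {γ η : ℝ → E} (hγ : IsSolutionOn F I γ) (hη : IsSolutionOn F I η) {s t : ℝ} (hs : s ∈ I)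
    (ht : t ∈ I) : ‖γ t - η t‖ ≤ 2 * ‖γ s - η s‖ * expWeight l s t := by
  have hsub : Set.uIcc s t ⊆ I := hI.uIcc_subset hs ht
  have hc := (hγ.mono hsub).continuousOn_uIcc.sub (hη.mono hsub).continuousOn_uIcc
  refine le_expWeight_of_le_integral hF.locallyIntegrable hF.nonneg (δ := fun x => ‖γ x - η x‖)
    hc.norm (fun _ => norm_nonneg _) fun x hx => ?_
  obtain ⟨i1, e1⟩ := hγ s hs x (hsub hx)
  obtain ⟨i2, e2⟩ := hη s hs x (hsub hx)
  have hcx : ContinuousOn (fun τ => ‖γ τ - η τ‖) (Set.uIcc s x) :=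
    hc.norm.mono (Set.uIcc_subset_uIcc Set.left_mem_uIcc hx)
  have h1 : γ x - η x = (γ s - η s) + ∫ τ in s..x, (F τ (γ τ) - F τ (η τ)) := by
    rw [intervalIntegral.integral_sub i1 i2, ← e1, ← e2]; abel
  change ‖γ x - η x‖ ≤ _
  rw [h1]
  refine (norm_add_le _ _).trans (add_le_add le_rfl ?_)
  exact intervalIntegral.norm_integral_le_abs_of_norm_le
    (Eventually.of_forall fun τ => hF.norm_sub_le τ _ _)
    ((hF.locallyIntegrable.intervalIntegrable_of_real s x).mul_continuousOn hcx)

/-- The weighted Picard operator. -/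
noncomputable def picardFun (F : ℝ → E → E) (l : ℝ → ℝ) (s : ℝ) (z : E) (β : ℝ → E) (t : ℝ) : E :=
  (expWeight l s t)⁻¹ • (z + ∫ τ in s..t, F τ (expWeight l s τ • β τ))

theorem continuous_picardFun (hF : IsLipschitzField F l) (s : ℝ) (z : E) (β : ℝ →ᵇ E) :
    Continuous (picardFun F l s z β) := by
  have hw := continuous_expWeight_right hF.locallyIntegrable s
  have h1 : Continuous fun t => ∫ τ in s..t, F τ (expWeight l s τ • β τ) :=
    intervalIntegral.continuous_primitive
      (hF.intervalIntegrable (γ := fun τ => expWeight l s τ • β τ) (hw.smul β.continuous)) s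
  exact (hw.inv₀ fun t => (expWeight_pos s t).ne').smul (continuous_const.add h1)

/-- The unknown is `β = γ / w` for the weight `w`. Solutions grow no faster than `w`, so `β` is
bounded on all of `ℝ` and one fixed point yields a global solution without continuation. -/
theorem norm_picardFun_le (hF : IsLipschitzField F l) (s : ℝ) (z : E) (β : ℝ →ᵇ E) (t : ℝ) :
    ‖picardFun F l s z β t‖ ≤ ‖z‖ + (1 + ‖β‖) := by
  have hw := one_le_expWeight (l := l) s t
  have hw0 := expWeight_pos (l := l) s t
  have hint := intervalIntegrable_mul_expWeight hF.locallyIntegrable s s t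
  have h1 : ‖∫ τ in s..t, F τ (expWeight l s τ • β τ)‖ ≤ (1 + ‖β‖) * (expWeight l s t / 2) := by
    calc _ ≤ |∫ τ in s..t, (1 + ‖β‖) * (l τ * expWeight l s τ)| := by
          refine intervalIntegral.norm_integral_le_abs_of_norm_le
            (Eventually.of_forall fun τ => ?_) (hint.const_mul _)
          refine (hF.norm_le τ _).trans ?_
          have h2 := one_le_expWeight (l := l) s τ
          have h3 : ‖expWeight l s τ • β τ‖ ≤ expWeight l s τ * ‖β‖ := by
            rw [norm_smul, Real.norm_of_nonneg (expWeight_pos _ _).le]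
            exact mul_le_mul_of_nonneg_left (β.norm_coe_le_norm τ) (expWeight_pos _ _).le
          rw [mul_left_comm]
          exact mul_le_mul_of_nonneg_left (by linarith) (hF.nonneg τ)
      _ = (1 + ‖β‖) * |∫ τ in s..t, l τ * expWeight l s τ| := by
          rw [intervalIntegral.integral_const_mul, abs_mul, abs_of_nonneg (by positivity)]
      _ ≤ _ := by
          gcongr; exact abs_integral_mul_expWeight_le hF.locallyIntegrable hF.nonneg s t
  rw [picardFun, norm_smul, norm_inv, Real.norm_of_nonneg hw0.le, inv_mul_le_iff₀ hw0]
  refine (norm_add_le _ _).trans ?_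
  nlinarith [norm_nonneg z, norm_nonneg β]

/-- The weighted Picard operator on bounded continuous functions. -/
noncomputable def picard (hF : IsLipschitzField F l) (s : ℝ) (z : E) (β : ℝ →ᵇ E) : ℝ →ᵇ E :=
  BoundedContinuousFunction.ofNormedAddCommGroup (picardFun F l s z β)
    (hF.continuous_picardFun s z β) _ (hF.norm_picardFun_le s z β)

/-- The Lipschitz bound gives an integrand of size `dist β η * l w`, whose integral is at most `dist
β η * w / 2`; division by `w` leaves the factor `1/2`. -/
theorem contractingWith_picard [CompleteSpace E] (hF : IsLipschitzField F l) (s : ℝ) (z : E) :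
    ContractingWith (1 / 2) (hF.picard s z) := by
  refine ⟨by norm_num, LipschitzWith.of_dist_le_mul fun β η => ?_⟩
  rw [BoundedContinuousFunction.dist_le (by positivity)]
  intro t
  have hw0 := expWeight_pos (l := l) s t
  have hw := continuous_expWeight_right hF.locallyIntegrable s
  have hint := intervalIntegrable_mul_expWeight hF.locallyIntegrable s s t
  have h1 : hF.picard s z β t - hF.picard s z η t = (expWeight l s t)⁻¹ •
      ∫ τ in s..t, (F τ (expWeight l s τ • β τ) - F τ (expWeight l s τ • η τ)) := by
    rw [intervalIntegral.integral_sub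
      (hF.intervalIntegrable (γ := fun τ => expWeight l s τ • β τ) (hw.smul β.continuous) s t)
      (hF.intervalIntegrable (γ := fun τ => expWeight l s τ • η τ) (hw.smul η.continuous) s t)]
    change picardFun F l s z β t - picardFun F l s z η t = _
    rw [picardFun, picardFun, ← smul_sub]
    congr 1
    abel
  rw [dist_eq_norm, h1, norm_smul, norm_inv, Real.norm_of_nonneg hw0.le, inv_mul_le_iff₀ hw0]
  calc _ ≤ |∫ τ in s..t, dist β η * (l τ * expWeight l s τ)| := by
        refine intervalIntegral.norm_integral_le_abs_of_norm_le
          (Eventually.of_forall fun τ => ?_) (hint.const_mul _)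
        refine (hF.norm_sub_le τ _ _).trans ?_
        rw [← smul_sub, norm_smul, Real.norm_of_nonneg (expWeight_pos _ _).le, mul_left_comm,
          mul_comm (dist β η)]
        rw [← dist_eq_norm (β τ), mul_assoc]
        have hd : dist (β τ) (η τ) ≤ dist β η := BoundedContinuousFunction.dist_coe_le_dist τ
        rw [mul_left_comm]
        exact mul_le_mul_of_nonneg_left (mul_le_mul_of_nonneg_left hd (expWeight_pos _ _).le)
          (hF.nonneg τ)
    _ = dist β η * |∫ τ in s..t, l τ * expWeight l s τ| := by
        rw [intervalIntegral.integral_const_mul, abs_mul, abs_of_nonneg dist_nonneg]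
    _ ≤ dist β η * (expWeight l s t / 2) := by
        gcongr; exact abs_integral_mul_expWeight_le hF.locallyIntegrable hF.nonneg s t
    _ = _ := by
        rw [show (((1 / 2 : NNReal)) : ℝ) = 1 / 2 by simp]; ring

theorem exists_solution [CompleteSpace E] (hF : IsLipschitzField F l) (s : ℝ) (z : E) :
    ∃ γ : ℝ → E, Continuous γ ∧ γ s = z ∧ IsSolutionOn F Set.univ γ := by
  obtain ⟨β, hβ⟩ : ∃ β, hF.picard s z β = β :=
    ⟨_, (hF.contractingWith_picard s z).fixedPoint_isFixedPt⟩
  have hw := continuous_expWeight_right hF.locallyIntegrable s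
  set γ : ℝ → E := fun τ => expWeight l s τ • β τ
  have hγc : Continuous γ := hw.smul β.continuous
  have hint := hF.intervalIntegrable hγc
  have hγ : ∀ t, γ t = z + ∫ τ in s..t, F τ (γ τ) := fun t => by
    have h1 : β t = picardFun F l s z β t := congrArg (fun b : ℝ →ᵇ E => b t) hβ.symm
    change expWeight l s t • β t = _
    rw [h1, picardFun, smul_smul, mul_inv_cancel₀ (expWeight_pos _ _).ne', one_smul]
  refine ⟨γ, hγc, by simp [hγ s], fun a _ b _ => ⟨hint a b, ?_⟩⟩
  rw [hγ a, hγ b, add_sub_add_left_eq_sub]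
  exact intervalIntegral.integral_interval_sub_left (hint s b) (hint s a)

theorem globallyWellPosed [CompleteSpace E] (hF : IsLipschitzField F l) :
    GloballyWellPosed F := by
  choose Γ hΓc hΓs hΓ using hF.exists_solution
  refine ⟨fun t s z => Γ s z t, fun s z => ⟨hΓs s z, hΓ s z⟩, fun I γ hI hγ s hs t ht => ?_, ?_⟩
  · have := hF.norm_sub_le_of_isSolutionOn hI hγ ((hΓ s (γ s)).mono (Set.subset_univ I)) hs ht
    rw [hΓs, sub_self, norm_zero, mul_zero, zero_mul] at this
    exact sub_eq_zero.1 (norm_le_zero_iff.1 this)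
  · rw [continuous_iff_continuousAt]
    rintro ⟨t₀, s₀, z₀⟩
    -- The solution through `(s, z)` is compared with the fixed one through `(s₀, z₀)`. At time `s`
    -- they differ by `z - Γ s₀ z₀ s`, which tends to zero because the fixed solution is continuous.
    have h1 : ∀ x : ℝ × ℝ × E, ‖Γ x.2.1 x.2.2 x.1 - Γ s₀ z₀ x.1‖ ≤
        2 * ‖x.2.2 - Γ s₀ z₀ x.2.1‖ * expWeight l x.2.1 x.1 := fun x => by
      have := hF.norm_sub_le_of_isSolutionOn Set.ordConnected_univ (hΓ x.2.1 x.2.2) (hΓ s₀ z₀)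
        (Set.mem_univ x.2.1) (Set.mem_univ x.1)
      rwa [hΓs] at this
    have hwc : Continuous fun x : ℝ × ℝ × E => expWeight l x.2.1 x.1 :=
      (continuous_expWeight hF.locallyIntegrable).comp
        (by fun_prop : Continuous fun x : ℝ × ℝ × E => (x.2.1, x.1))
    have hc := hΓc s₀ z₀
    have h2 : Tendsto (fun x : ℝ × ℝ × E => 2 * ‖x.2.2 - Γ s₀ z₀ x.2.1‖ * expWeight l x.2.1 x.1)
        (𝓝 (t₀, s₀, z₀)) (𝓝 0) := by
      have h3 : Continuous fun x : ℝ × ℝ × E =>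
          2 * ‖x.2.2 - Γ s₀ z₀ x.2.1‖ * expWeight l x.2.1 x.1 := by fun_prop
      have := h3.tendsto (t₀, s₀, z₀)
      simpa [hΓs] using this
    have h4 : Tendsto (fun x : ℝ × ℝ × E => Γ x.2.1 x.2.2 x.1 - Γ s₀ z₀ x.1)
        (𝓝 (t₀, s₀, z₀)) (𝓝 0) := squeeze_zero_norm h1 h2
    have h5 : Tendsto (fun x : ℝ × ℝ × E => Γ s₀ z₀ x.1) (𝓝 (t₀, s₀, z₀)) (𝓝 (Γ s₀ z₀ t₀)) :=
      (hc.comp continuous_fst).tendsto (t₀, s₀, z₀)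
    simpa [ContinuousAt] using h4.add h5

end IsLipschitzField

end Caratheodory

end GaussianWavePacket

namespace GaussianWavePacket

/-! ### Autonomous equations with a coercive conserved quantity -/

section Autonomous

variable {E : Type*} [NormedAddCommGroup E] [InnerProductSpace ℝ E] [FiniteDimensional ℝ E]

/-- Multiplying a `C¹` vector field by a smooth cutoff function gives a globally well-posed
equation. -/
theorem globallyWellPosed_cutoff {F : E → E} (hF : ContDiff ℝ 1 F)
    (χ : ContDiffBump (0 : E)) : GloballyWellPosed fun _ z => χ z • F z := by
  have hc : ContDiff ℝ 1 fun z => χ z • F z := χ.contDiff.smul hF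
  have hs : HasCompactSupport fun z => χ z • F z := χ.hasCompactSupport.smul_right
  obtain ⟨C, hC⟩ := hc.lipschitzWith_of_hasCompactSupport hs one_ne_zero
  refine IsLipschitzField.globallyWellPosed (l := fun _ => C + ‖χ 0 • F 0‖)
    ⟨locallyIntegrable_const _, fun _ => by positivity, fun _ => ?_, fun _ x y => ?_,
      fun γ hγ => (hc.continuous.comp hγ).aestronglyMeasurable⟩
  · exact le_add_of_nonneg_left C.2
  · refine (hC.norm_sub_le x y).trans ?_
    gcongr
    exact le_add_of_nonneg_right (norm_nonneg _)

/-- An autonomous `C¹` vector field with a coercive conserved quantity is globally well-posed. -/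
theorem globallyWellPosed_of_coercive {F : E → E} (hF : ContDiff ℝ 1 F) {H : E → ℝ}
    (hH : ContDiff ℝ 2 H) (hco : Coercive H) (hcons : ∀ z, fderiv ℝ H z (F z) = 0) :
    GloballyWellPosed fun _ => F := by
  have hbdd : ∀ c : ℝ, ∃ R > 0, ∀ z, H z ≤ c → ‖z‖ ≤ R := fun c => by
    have h1 : ∀ᶠ z in Bornology.cobounded E, c < H z := hco.eventually_gt_atTop c
    obtain ⟨R, -, hR⟩ := (hasBasis_cobounded_norm (E := E)).eventually_iff.1 h1
    refine ⟨|R| + 1, by positivity, fun z hz => ?_⟩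
    by_contra! hlt
    exact (hR (show R ≤ ‖z‖ by linarith [le_abs_self R])).not_ge hz
  choose R hR0 hR using hbdd
  let χ : ℝ → ContDiffBump (0 : E) := fun c => ⟨R c, R c + 1, hR0 c, by linarith⟩
  have hχ1 : ∀ c z, H z ≤ c → χ c z = 1 := fun c z hz =>
    (χ c).one_of_mem_closedBall (mem_closedBall_zero_iff.2 (hR c z hz))
  choose Ψ hΨ1 hΨ2 hΨ3 using fun c => globallyWellPosed_cutoff hF (χ c)
  -- A scalar multiple of `F` still conserves `H`, so a cut-off solution that starts in `{H ≤ c}`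
  -- stays there, where the cutoff equals `1`.
  have hconsχ : ∀ c, ∀ (_ : ℝ) z, fderiv ℝ H z (χ c z • F z) = 0 := fun c _ z => by
    rw [map_smul, hcons, smul_zero]
  have hsol : ∀ c s z, H z ≤ c → IsSolutionOn (fun _ => F) Set.univ fun t => Ψ c t s z := by
    intro c s z hz
    obtain ⟨e1, e2⟩ := hΨ1 c s z
    refine e2.congr Set.ordConnected_univ fun t _ => ?_
    have h1 := e2.conserved Set.ordConnected_univ hH (hconsχ c) (Set.mem_univ s) (Set.mem_univ t)
    simp only [e1] at h1
    rw [hχ1 c _ (h1.trans_le hz), one_smul]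
  have huniq : ∀ c (I : Set ℝ) (γ : ℝ → E), I.OrdConnected → IsSolutionOn (fun _ => F) I γ →
      ∀ s ∈ I, H (γ s) ≤ c → ∀ t ∈ I, γ t = Ψ c t s (γ s) := by
    intro c I γ hI hγ s hs hc t ht
    refine hΨ2 c I γ hI (hγ.congr hI fun τ hτ => ?_) s hs t ht
    have h1 := hγ.conserved hI hH (fun _ z => hcons z) hs hτ
    rw [hχ1 c _ (h1.trans_le hc), one_smul]
  have heq : ∀ c s z t, H z ≤ c → Ψ (H z) t s z = Ψ c t s z := by
    intro c s z t hz
    have := huniq c Set.univ (fun t => Ψ (H z) t s z) Set.ordConnected_univ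
      (hsol (H z) s z le_rfl) s (Set.mem_univ s) (by simpa [(hΨ1 (H z) s z).1] using hz) t
      (Set.mem_univ t)
    simpa [(hΨ1 (H z) s z).1] using this
  -- The cutoff level is the energy of the initial value; `heq` shows that any higher level gives
  -- the same solution.
  refine ⟨fun t s z => Ψ (H z) t s z, fun s z => ⟨(hΨ1 _ s z).1, hsol _ s z le_rfl⟩,
    fun I γ hI hγ s hs t ht => huniq _ I γ hI hγ s hs le_rfl t ht, ?_⟩
  rw [continuous_iff_continuousAt]
  rintro ⟨t₀, s₀, z₀⟩
  -- Near `z₀` the energy stays below `H z₀ + 1`, so a single cut-off flow represents the solution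
  -- on a neighbourhood.
  refine ((hΨ3 (H z₀ + 1)).continuousAt (x := (t₀, s₀, z₀))).congr ?_
  have hc : Continuous fun x : ℝ × ℝ × E => H x.2.2 := hH.continuous.comp (by fun_prop)
  filter_upwards [hc.continuousAt.eventually_lt_const
    (show H (t₀, s₀, z₀).2.2 < H z₀ + 1 by simp)] with x hx
  exact (heq _ _ _ _ hx.le).symm

end Autonomous

end GaussianWavePacket

namespace GaussianWavePacket

/-! ### Integration by parts and conservation of symplecticity -/

variable {d : ℕ}

theorem integrable_mul_averageIntegrand {a : ClassicalPhase d → ℝ} (ha : ContDiff ℝ ∞ a)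
    (hexp : ExponentialGrowth a) (Z : ParamPhase d) {q : ClassicalPhase d → ℝ} (hq : Continuous q)
    {n : ℕ} {c : ℝ} (hc : 0 ≤ c) (hle : ∀ ζ, |q ζ| ≤ c * (1 + ‖ζ‖) ^ n) :
    Integrable fun ζ => q ζ * averageIntegrand a Z ζ := by
  obtain ⟨C, β, hβ, hC⟩ := hexp 0
  have hC0 : 0 ≤ C := by
    have := (norm_nonneg _).trans (hC 0)
    simpa using this
  set R := β * (argBound d * ‖Z‖)
  have hac := ha.continuous
  have hcont : Continuous fun ζ => q ζ * averageIntegrand a Z ζ := by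
    simp only [averageIntegrand_eq]
    fun_prop
  refine ((integrable_pow_mul_exp_mul_gaussian n R).const_mul (c * C * Real.exp R)).mono'
    hcont.aestronglyMeasurable (Eventually.of_forall fun ζ => ?_)
  have h1 : ‖argMap ζ Z‖ ≤ argBound d * (1 + ‖ζ‖) * ‖Z‖ :=
    ((argMap ζ).le_opNorm Z).trans (by gcongr; exact norm_argMap_le ζ)
  have h2 : |a (argMap ζ Z)| ≤ C * (Real.exp R * Real.exp (R * ‖ζ‖)) := by
    have h3 := hC (argMap ζ Z)
    rw [norm_iteratedFDeriv_zero, Real.norm_eq_abs] at h3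
    refine h3.trans ?_
    rw [← Real.exp_add]
    gcongr
    calc β * ‖argMap ζ Z‖ ≤ β * (argBound d * (1 + ‖ζ‖) * ‖Z‖) := by gcongr
      _ = _ := by simp only [R]; ring
  rw [averageIntegrand_eq, Real.norm_eq_abs, abs_mul, smul_eq_mul, abs_mul, Real.abs_exp]
  calc _ ≤ (c * (1 + ‖ζ‖) ^ n) * (Real.exp (-(1 / 2) * ‖ζ‖ ^ 2) *
        (C * (Real.exp R * Real.exp (R * ‖ζ‖)))) := by gcongr; exacts [hle ζ, h2]
    _ = _ := by ring

theorem hasFDerivAt_gaussian (ζ : ClassicalPhase d) :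
    HasFDerivAt (fun ζ : ClassicalPhase d => Real.exp (-(1 / 2) * ‖ζ‖ ^ 2))
      (-(Real.exp (-(1 / 2) * ‖ζ‖ ^ 2)) • innerSL ℝ ζ) ζ := by
  have h := (((hasStrictFDerivAt_norm_sq ζ).hasFDerivAt).const_mul (-(1 / 2) : ℝ)).exp
  refine h.congr_fderiv ?_
  ext v
  simp

/-- Integration by parts for the gradient of a Gaussian average. -/
theorem integral_gaussian_mul_fderiv {a : ClassicalPhase d → ℝ} (ha : ContDiff ℝ ∞ a)
    (hexp : ExponentialGrowth a) (Z : ParamPhase d) (u v : ClassicalPhase d)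
    (hint : Integrable fun ζ => Real.exp (-(1 / 2) * ‖ζ‖ ^ 2) *
      (inner ℝ u ζ * fderiv ℝ a (argMap ζ Z) (covMap v Z))) :
    ∫ ζ, Real.exp (-(1 / 2) * ‖ζ‖ ^ 2) * (inner ℝ u ζ * fderiv ℝ a (argMap ζ Z) (covMap v Z)) =
      -∫ ζ, (inner ℝ u v - inner ℝ u ζ * inner ℝ v ζ) * averageIntegrand a Z ζ := by
  set ψ : ClassicalPhase d → ℝ := fun ζ => a (argMap ζ Z)
  have hψ : ∀ ζ, HasFDerivAt ψ ((fderiv ℝ a (argMap ζ Z)).comp (covMap.flip Z)) ζ := fun ζ => by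
    have h1 : HasFDerivAt (fun ζ => argMap ζ Z) ((covMap (d := d)).flip Z) ζ :=
      ((covMap (d := d)).flip Z).hasFDerivAt.add_const (centreMap Z)
    exact ((ha.differentiable (by simp)) _).hasFDerivAt.comp ζ h1
  -- The derivative in direction `v` is moved from `ψ` onto the Gaussian times `⟨u, ζ⟩`; this
  -- produces the kernel `⟨u, v⟩ - ⟨u, ζ⟩ ⟨v, ζ⟩`.
  set f : ClassicalPhase d → ℝ := fun ζ => Real.exp (-(1 / 2) * ‖ζ‖ ^ 2) * inner ℝ u ζ
  have hf : ∀ ζ, HasFDerivAt f (Real.exp (-(1 / 2) * ‖ζ‖ ^ 2) • innerSL ℝ u +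
      (inner ℝ u ζ : ℝ) • (-(Real.exp (-(1 / 2) * ‖ζ‖ ^ 2)) • innerSL ℝ ζ)) ζ := fun ζ =>
    (hasFDerivAt_gaussian ζ).mul (innerSL ℝ u).hasFDerivAt
  have hfd : ∀ ζ, fderiv ℝ f ζ v * ψ ζ =
      (inner ℝ u v - inner ℝ u ζ * inner ℝ v ζ) * averageIntegrand a Z ζ := fun ζ => by
    rw [(hf ζ).fderiv, averageIntegrand_eq, real_inner_comm ζ v]
    simp only [add_apply, smul_apply, innerSL_apply_apply, smul_eq_mul, Function.comp, ψ]
    ring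
  have hfg : ∀ ζ, f ζ * fderiv ℝ ψ ζ v = Real.exp (-(1 / 2) * ‖ζ‖ ^ 2) *
      (inner ℝ u ζ * fderiv ℝ a (argMap ζ Z) (covMap v Z)) := fun ζ => by
    rw [(hψ ζ).fderiv]
    simp only [f, ContinuousLinearMap.comp_apply, ContinuousLinearMap.flip_apply]
    ring
  have hab : ∀ u ζ : ClassicalPhase d, |inner ℝ u ζ| ≤ ‖u‖ * (1 + ‖ζ‖) := fun u ζ =>
    (abs_real_inner_le_norm u ζ).trans (by gcongr; linarith)
  have i1 : Integrable fun ζ => (inner ℝ u v - inner ℝ u ζ * inner ℝ v ζ) *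
      averageIntegrand a Z ζ := by
    refine integrable_mul_averageIntegrand ha hexp Z (by fun_prop) (n := 2)
      (c := |inner ℝ u v| + ‖u‖ * ‖v‖) (by positivity) fun ζ => ?_
    refine (abs_sub _ _).trans ?_
    rw [abs_mul, add_mul]
    refine add_le_add (le_mul_of_one_le_right (abs_nonneg _) (one_le_pow₀ (by simp))) ?_
    calc _ ≤ (‖u‖ * (1 + ‖ζ‖)) * (‖v‖ * (1 + ‖ζ‖)) :=
          mul_le_mul (hab u ζ) (hab v ζ) (abs_nonneg _) (by positivity)
      _ = _ := by ring
  have i2 : Integrable fun ζ => f ζ * ψ ζ := by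
    refine (integrable_mul_averageIntegrand ha hexp Z (q := fun ζ => inner ℝ u ζ) (by fun_prop)
      (n := 1) (norm_nonneg u) fun ζ => by simpa using hab u ζ).congr
      (Eventually.of_forall fun ζ => ?_)
    simp only [averageIntegrand_eq, f, ψ, Function.comp, smul_eq_mul]
    ring
  have := integral_mul_fderiv_eq_neg_fderiv_mul_of_integrable (μ := volume) (f := f) (g := ψ)
    (v := v) (by simpa only [hfd] using i1) (by simpa only [hfg] using hint) i2
    (fun ζ _ => (hf ζ).differentiableAt) (fun ζ _ => (hψ ζ).differentiableAt)
  simpa only [hfd, hfg] using this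

/-- The coordinate of the parameter space that holds the entry `(r, k)` of the covariance factor. -/
def covIdx : Fin d ⊕ Fin d → Fin d ⊕ Fin d → ConfIdx d ⊕ ConfIdx d
  | Sum.inl j, Sum.inl k => Sum.inl (Sum.inr (Sum.inl (j, k)))
  | Sum.inl j, Sum.inr k => Sum.inl (Sum.inr (Sum.inr (j, k)))
  | Sum.inr j, Sum.inl k => Sum.inr (Sum.inr (Sum.inl (j, k)))
  | Sum.inr j, Sum.inr k => Sum.inr (Sum.inr (Sum.inr (j, k)))

theorem covFactor_apply (Z : ParamPhase d) (r k : Fin d ⊕ Fin d) :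
    covFactor Z r k = Z (covIdx r k) := by
  rcases r with r | r <;> rcases k with k | k <;> rfl

theorem covIdx_inj {r k r' k' : Fin d ⊕ Fin d} :
    covIdx r k = covIdx r' k' ↔ r = r' ∧ k = k' := by
  rcases r with r | r <;> rcases k with k | k <;> rcases r' with r' | r' <;>
    rcases k' with k' | k' <;> simp [covIdx]

theorem argMap_single (ζ : ClassicalPhase d) (r k : Fin d ⊕ Fin d) :
    argMap ζ (EuclideanSpace.single (covIdx r k) 1) = ζ k • EuclideanSpace.single r 1 := by
  ext i
  rw [argMap_apply]
  have hc : centre (EuclideanSpace.single (covIdx r k) (1 : ℝ)) = 0 := by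
    ext i
    rcases r with r | r <;> rcases k with k | k <;> rcases i with i | i <;>
      simp [centre, posCentre, momCentre, covIdx]
  rw [hc, add_zero]
  simp only [Matrix.mulVec, dotProduct, covFactor_apply]
  by_cases hir : i = r
  · simp [covIdx_inj, hir]
  · simp [covIdx_inj, hir]

/-- The partial derivative with respect to the entry `(r, k)` of the covariance factor. -/
noncomputable def covDeriv (H : ParamPhase d → ℝ) (Z : ParamPhase d) (r k : Fin d ⊕ Fin d) : ℝ :=
  fderiv ℝ H Z (EuclideanSpace.single (covIdx r k) 1)

/-- The sum is the derivative of the average in the direction `W` that carries column `k` of `Y_ε`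
in column `j`. There `argMap ζ W = ζ j • Y_ε e_k`, so the integrand contains the derivative of `ζ ↦
a (Y_ε ζ + z)` along `e_k` and can be integrated by parts. The resulting kernel is symmetric in `j`
and `k`. -/
theorem sum_covDeriv_mul {a : ClassicalPhase d → ℝ} (ha : ContDiff ℝ ∞ a)
    (hexp : ExponentialGrowth a) (Z : ParamPhase d) (j k : Fin d ⊕ Fin d) :
    ∑ r, covDeriv (gaussianAverage a) Z r j * covFactor Z r k = ((2 * Real.pi) ^ d)⁻¹ *
      -∫ ζ, (inner ℝ (EuclideanSpace.single j (1 : ℝ)) (EuclideanSpace.single k (1 : ℝ)) -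
        inner ℝ (EuclideanSpace.single j (1 : ℝ)) ζ * inner ℝ (EuclideanSpace.single k (1 : ℝ)) ζ) *
          averageIntegrand a Z ζ := by
  set W : ParamPhase d := ∑ r, covFactor Z r k • EuclideanSpace.single (covIdx r j) 1
  have hW : ∑ r, covDeriv (gaussianAverage a) Z r j * covFactor Z r k =
      fderiv ℝ (gaussianAverage a) Z W := by
    simp only [W, map_sum, map_smul, smul_eq_mul, covDeriv, mul_comm]
  have harg : ∀ ζ, argMap ζ W = ζ j • covMap (EuclideanSpace.single k 1) Z := fun ζ => by
    simp only [W, map_sum, map_smul, argMap_single, smul_comm _ (ζ j), ← Finset.smul_sum]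
    congr 1
    ext i
    rcases i with i | i <;> simp [covMap_apply, Finset.sum_apply, Pi.single_apply]
  have hfun : ∀ ζ, Real.exp (-(1 / 2) * ‖ζ‖ ^ 2) * fderiv ℝ a (argMap ζ Z) (argMap ζ W) =
      Real.exp (-(1 / 2) * ‖ζ‖ ^ 2) * (inner ℝ (EuclideanSpace.single j (1 : ℝ)) ζ *
        fderiv ℝ a (argMap ζ Z) (covMap (EuclideanSpace.single k 1) Z)) := fun ζ => by
    rw [harg, map_smul, smul_eq_mul]
    simp [EuclideanSpace.inner_single_left]
  have hint := integrable_fderiv_argMap ha hexp Z W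
  simp only [hfun] at hint
  rw [hW, fderiv_gaussianAverage ha hexp]
  simp only [hfun]
  rw [integral_gaussian_mul_fderiv ha hexp Z _ _ hint]

/-- The matrix `(∂H/∂Y)ᵀ Y` is symmetric for a Gaussian average `H`. -/
theorem sum_covDeriv_mul_comm {a : ClassicalPhase d → ℝ} (ha : ContDiff ℝ ∞ a)
    (hexp : ExponentialGrowth a) (Z : ParamPhase d) (j k : Fin d ⊕ Fin d) :
    ∑ r, covDeriv (gaussianAverage a) Z r j * covFactor Z r k =
      ∑ r, covDeriv (gaussianAverage a) Z r k * covFactor Z r j := by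
  rw [sum_covDeriv_mul ha hexp, sum_covDeriv_mul ha hexp, real_inner_comm]
  congr 3 with ζ
  ring

theorem gradient_apply (H : ParamPhase d → ℝ) (Z : ParamPhase d) (i : ConfIdx d ⊕ ConfIdx d) :
    (gradient H Z) i = fderiv ℝ H Z (EuclideanSpace.single i 1) := by
  have h : inner ℝ (gradient H Z) (EuclideanSpace.single i 1) =
      fderiv ℝ H Z (EuclideanSpace.single i 1) :=
    InnerProductSpace.toDual_symm_apply
  rw [← h, EuclideanSpace.inner_single_right]
  simp

theorem hamiltonField_inl (H : ParamPhase d → ℝ) (Z : ParamPhase d) (i : ConfIdx d) :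
    hamiltonField H Z (Sum.inl i) = fderiv ℝ H Z (EuclideanSpace.single (Sum.inr i) 1) := by
  rw [← gradient_apply]
  simp [hamiltonField, structureMatrix, Matrix.mulVec, dotProduct, Fintype.sum_sum_type,
    Matrix.one_apply]

theorem hamiltonField_inr (H : ParamPhase d → ℝ) (Z : ParamPhase d) (i : ConfIdx d) :
    hamiltonField H Z (Sum.inr i) = -fderiv ℝ H Z (EuclideanSpace.single (Sum.inl i) 1) := by
  rw [← gradient_apply]
  simp [hamiltonField, structureMatrix, Matrix.mulVec, dotProduct, Fintype.sum_sum_type,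
    Matrix.one_apply]

/-- Conservation of energy. -/
theorem fderiv_hamiltonField (H : ParamPhase d → ℝ) (Z : ParamPhase d) :
    fderiv ℝ H Z (hamiltonField H Z) = 0 := by
  have h1 : ∀ X, fderiv ℝ H Z X = ∑ i, X i * fderiv ℝ H Z (EuclideanSpace.single i 1) := fun X => by
    conv_lhs => rw [← (EuclideanSpace.basisFun (ConfIdx d ⊕ ConfIdx d) ℝ).sum_repr X]
    simp [map_sum]
  rw [h1, Fintype.sum_sum_type]
  simp only [hamiltonField_inl, hamiltonField_inr]
  rw [← Finset.sum_add_distrib]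
  exact Finset.sum_eq_zero fun i _ => by ring

theorem covFactor_hamiltonField_inl (H : ParamPhase d → ℝ) (Z : ParamPhase d) (i : Fin d)
    (k : Fin d ⊕ Fin d) : hamiltonField H Z (covIdx (Sum.inl i) k) = covDeriv H Z (Sum.inr i) k := by
  rcases k with k | k <;> exact hamiltonField_inl H Z _

theorem covFactor_hamiltonField_inr (H : ParamPhase d → ℝ) (Z : ParamPhase d) (i : Fin d)
    (k : Fin d ⊕ Fin d) :
    hamiltonField H Z (covIdx (Sum.inr i) k) = -covDeriv H Z (Sum.inl i) k := by
  rcases k with k | k <;> exact hamiltonField_inr H Z _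

/-- The entry `(j, k)` of `Yᵀ Ω Y`. -/
noncomputable def sympEntry (j k : Fin d ⊕ Fin d) (Z : ParamPhase d) : ℝ :=
  ∑ i : Fin d, (Z (covIdx (Sum.inl i) j) * Z (covIdx (Sum.inr i) k) -
    Z (covIdx (Sum.inr i) j) * Z (covIdx (Sum.inl i) k))

theorem sympEntry_eq (j k : Fin d ⊕ Fin d) (Z : ParamPhase d) :
    ((covFactor Z).transpose * structureMatrix (Fin d) * covFactor Z) j k = sympEntry j k Z := by
  simp [Matrix.mul_apply, structureMatrix, Fintype.sum_sum_type, Matrix.one_apply,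
    covFactor_apply, sympEntry, Finset.sum_sub_distrib]
  ring

theorem contDiff_sympEntry (j k : Fin d ⊕ Fin d) : ContDiff ℝ 2 (sympEntry j k) := by
  unfold sympEntry
  fun_prop

theorem fderiv_sympEntry (j k : Fin d ⊕ Fin d) (Z X : ParamPhase d) :
    fderiv ℝ (sympEntry j k) Z X =
      ∑ i : Fin d, (Z (covIdx (Sum.inl i) j) * X (covIdx (Sum.inr i) k) +
        Z (covIdx (Sum.inr i) k) * X (covIdx (Sum.inl i) j) -
        (Z (covIdx (Sum.inr i) j) * X (covIdx (Sum.inl i) k) +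
          Z (covIdx (Sum.inl i) k) * X (covIdx (Sum.inr i) j))) := by
  have hp : ∀ i, HasFDerivAt (fun Z : ParamPhase d => Z i)
    (EuclideanSpace.proj i : ParamPhase d →L[ℝ] ℝ) Z := fun i =>
      (EuclideanSpace.proj i : ParamPhase d →L[ℝ] ℝ).hasFDerivAt
  have h : HasFDerivAt (sympEntry j k) _ Z := HasFDerivAt.fun_sum (u := Finset.univ) fun i _ =>
    ((hp (covIdx (Sum.inl i) j)).mul (hp (covIdx (Sum.inr i) k))).sub
      ((hp (covIdx (Sum.inr i) j)).mul (hp (covIdx (Sum.inl i) k)))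
  rw [h.fderiv]
  simp

/-- With `G = ∂H/∂Y` the flow moves `Y` by `Ω G`, and the derivative of `Yᵀ Ω Y` is `Gᵀ Y - Yᵀ G`,
which vanishes because `Gᵀ Y` is symmetric. -/
theorem fderiv_sympEntry_hamiltonField {a : ClassicalPhase d → ℝ} (ha : ContDiff ℝ ∞ a)
    (hexp : ExponentialGrowth a) (j k : Fin d ⊕ Fin d) (Z : ParamPhase d) :
    fderiv ℝ (sympEntry j k) Z (hamiltonField (gaussianAverage a) Z) = 0 := by
  have h := sum_covDeriv_mul_comm ha hexp Z j k
  rw [Fintype.sum_sum_type, Fintype.sum_sum_type] at h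
  rw [fderiv_sympEntry]
  simp only [covFactor_hamiltonField_inl, covFactor_hamiltonField_inr,
    Finset.sum_sub_distrib, Finset.sum_add_distrib, mul_neg, Finset.sum_neg_distrib]
  simp only [← covFactor_apply]
  simp only [mul_comm (covDeriv _ _ _ _)] at h
  linarith

theorem preservesWavePackets {h : ℝ → ClassicalPhase d → ℝ} (ε : ℝ)
    (hsmooth : ∀ t, ContDiff ℝ ∞ (h t)) (hexp : ∀ t, ExponentialGrowth (h t)) :
    PreservesWavePackets ε fun t => hamiltonField (gaussianAverage (h t)) := by
  intro I γ hI hγ s hs hadm t ht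
  rw [IsAdmissible] at hadm ⊢
  rw [← hadm]
  ext j k
  rw [sympEntry_eq, sympEntry_eq]
  exact hγ.conserved hI (contDiff_sympEntry j k)
    (fun t Z => fderiv_sympEntry_hamiltonField (hsmooth t) (hexp t) j k Z) hs ht

end GaussianWavePacket

namespace GaussianWavePacket

/-! ### Well-posedness of the variational equations -/

variable {d : ℕ}

variable (d) in
/-- The linear map from the differential of a Hamiltonian to its Hamiltonian vector. -/
noncomputable def hamiltonMap : (ParamPhase d →L[ℝ] ℝ) →L[ℝ] ParamPhase d :=
  LinearMap.toContinuousLinearMap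
    { toFun := fun φ => WithLp.toLp 2 ((structureMatrix (ConfIdx d)).mulVec
        ((InnerProductSpace.toDual ℝ (ParamPhase d)).symm φ).ofLp)
      map_add' := fun φ ψ => by simp [Matrix.mulVec_add]
      map_smul' := fun c φ => by simp [Matrix.mulVec_smul] }

theorem hamiltonField_eq (H : ParamPhase d → ℝ) (Z : ParamPhase d) :
    hamiltonField H Z = hamiltonMap d (fderiv ℝ H Z) := rfl

theorem two_le_infty : (2 : ℕ∞ω) ≤ ∞ := ENat.LEInfty.out

theorem contDiff_hamiltonField {H : ParamPhase d → ℝ} (hH : ContDiff ℝ ∞ H) :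
    ContDiff ℝ 1 (hamiltonField H) :=
  (hamiltonMap d).contDiff.comp ((hH.of_le two_le_infty).fderiv_right (by norm_num))

theorem globallyWellPosed_of_coercive_symbol {a : ClassicalPhase d → ℝ} (ha : ContDiff ℝ ∞ a)
    (hexp : ExponentialGrowth a) (hco : Coercive a) :
    GloballyWellPosed fun _ => hamiltonField (gaussianAverage a) :=
  have hH := contDiff_gaussianAverage ha hexp
  globallyWellPosed_of_coercive (contDiff_hamiltonField hH) (hH.of_le two_le_infty)
    (coercive_gaussianAverage ha hexp hco) (fderiv_hamiltonField _)

/-- Continuity in `z` and measurability in `t` make the symbol jointly measurable, and integrating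
out `ζ` preserves measurability in `t`. -/
theorem measurable_gaussianAverage {h : ℝ → ClassicalPhase d → ℝ}
    (hsmooth : ∀ t, ContDiff ℝ ∞ (h t)) (hmeas : ∀ z, Measurable fun t => h t z)
    (Z : ParamPhase d) : Measurable fun t => gaussianAverage (h t) Z := by
  have h1 : Measurable (Function.uncurry fun (z : ClassicalPhase d) t => h t z) :=
    measurable_uncurry_of_continuous_of_measurable (fun t => (hsmooth t).continuous) hmeas
  have h2 : Measurable fun x : ℝ × ClassicalPhase d => averageIntegrand (h x.1) Z x.2 := by
    simp only [averageIntegrand_eq]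
    have h3 : Measurable fun x : ℝ × ClassicalPhase d => (argMap x.2 Z, x.1) := by fun_prop
    have h4 : Measurable fun x : ℝ × ClassicalPhase d => Real.exp (-(1 / 2) * ‖x.2‖ ^ 2) := by
      fun_prop
    exact h4.smul (h1.comp h3)
  exact (h2.stronglyMeasurable.integral_prod_right).measurable.const_mul _

/-- Directional derivatives are pointwise limits of difference quotients, each of them measurable in
`t`. -/
theorem measurable_hamiltonField {h : ℝ → ClassicalPhase d → ℝ}
    (hsmooth : ∀ t, ContDiff ℝ ∞ (h t)) (hexp : ∀ t, ExponentialGrowth (h t))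
    (hmeas : ∀ z, Measurable fun t => h t z) (Z : ParamPhase d) :
    Measurable fun t => hamiltonField (gaussianAverage (h t)) Z := by
  have hd : ∀ v, Measurable fun t => fderiv ℝ (gaussianAverage (h t)) Z v := fun v => by
    refine measurable_of_tendsto_metrizable (f := fun (n : ℕ) t =>
      (n : ℝ) • (gaussianAverage (h t) (Z + (n : ℝ)⁻¹ • v) - gaussianAverage (h t) Z))
      (fun n => ?_) (tendsto_pi_nhds.2 fun t => ?_)
    · exact ((measurable_gaussianAverage hsmooth hmeas _).sub
        (measurable_gaussianAverage hsmooth hmeas _)).const_mul (n : ℝ)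
    · have hdiff := ((contDiff_gaussianAverage (hsmooth t) (hexp t)).differentiable (by simp)) Z
      exact hdiff.hasFDerivAt.lim v (by simpa using tendsto_natCast_atTop_atTop (R := ℝ))
  have hi : ∀ i, Measurable fun t => hamiltonField (gaussianAverage (h t)) Z i := fun i => by
    rcases i with i | i
    · simp only [hamiltonField_inl]; exact hd _
    · simp only [hamiltonField_inr]; exact (hd _).neg
  exact (WithLp.measurable_toLp 2 _).comp (measurable_pi_lambda _ hi)

theorem norm_fderiv_gaussianAverage_sub_le {a : ClassicalPhase d → ℝ} (ha : ContDiff ℝ ∞ a)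
    (hexp : ExponentialGrowth a) {C : ℝ} (hC : ∀ z, ‖iteratedFDeriv ℝ 2 a z‖ ≤ C)
    (Z W : ParamPhase d) :
    ‖fderiv ℝ (gaussianAverage a) Z - fderiv ℝ (gaussianAverage a) W‖ ≤
      C * averageConst d 2 * ‖Z - W‖ := by
  have hH := contDiff_gaussianAverage ha hexp
  have h1 : ContDiff ℝ 1 (fderiv ℝ (gaussianAverage a)) :=
    (hH.of_le two_le_infty).fderiv_right (by norm_num)
  refine convex_univ.norm_image_sub_le_of_norm_fderiv_le
    (fun x _ => (h1.differentiable one_ne_zero) x) (fun x _ => ?_) (Set.mem_univ W) (Set.mem_univ Z)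
  rw [← norm_iteratedFDeriv_one, norm_iteratedFDeriv_fderiv]
  exact norm_iteratedFDeriv_gaussianAverage_le ha hexp 2 x fun ζ => hC _

theorem norm_fderiv_gaussianAverage_zero_le {a : ClassicalPhase d → ℝ} (ha : ContDiff ℝ ∞ a)
    (hexp : ExponentialGrowth a) :
    ‖fderiv ℝ (gaussianAverage a) 0‖ ≤ ‖gradient a 0‖ * averageConst d 1 := by
  rw [← norm_iteratedFDeriv_one]
  refine norm_iteratedFDeriv_gaussianAverage_le ha hexp 1 0 fun ζ => ?_
  rw [map_zero, norm_iteratedFDeriv_one]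
  exact ((InnerProductSpace.toDual ℝ (ClassicalPhase d)).symm.norm_map _).ge

theorem globallyWellPosed_of_subquadratic {h : ℝ → ClassicalPhase d → ℝ}
    (hsmooth : ∀ t, ContDiff ℝ ∞ (h t)) (hexp : ∀ t, ExponentialGrowth (h t))
    (hsub : Subquadratic h) (hmeas : ∀ z, Measurable fun t => h t z)
    (hgrad : LocallyIntegrable fun t => gradient (h t) 0) :
    GloballyWellPosed fun t => hamiltonField (gaussianAverage (h t)) := by
  obtain ⟨C, hCi, hC⟩ := hsub 2 le_rfl
  have hC0 : ∀ t, 0 ≤ C t := fun t => (norm_nonneg _).trans (hC t 0)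
  have hc1 := averageConst_nonneg (d := d) 1
  have hc2 := averageConst_nonneg (d := d) 2
  have hJ := norm_nonneg (hamiltonMap d)
  -- The first summand bounds the Lipschitz constant of the field, through second derivatives of
  -- `h`; the second bounds its value at the origin, through `∇h(t, 0)`.
  have hli : LocallyIntegrable ((‖hamiltonMap d‖ * averageConst d 2) • C +
      (‖hamiltonMap d‖ * averageConst d 1) • fun t => ‖gradient (h t) 0‖) :=
    (hCi.smul _).add (LocallyIntegrable.smul (fun x => (hgrad x).norm) _)
  refine IsLipschitzField.globallyWellPosed ⟨hli, fun t => ?_, fun t => ?_, fun t Z W => ?_,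
    fun γ hγ => ?_⟩
  · have := hC0 t
    simp only [Pi.add_apply, Pi.smul_apply, smul_eq_mul]
    positivity
  · refine ((hamiltonMap d).le_opNorm _).trans ?_
    have h1 := norm_fderiv_gaussianAverage_zero_le (hsmooth t) (hexp t)
    have h2 := mul_nonneg (mul_nonneg hJ hc2) (hC0 t)
    have h3 := mul_le_mul_of_nonneg_left h1 hJ
    simp only [Pi.add_apply, Pi.smul_apply, smul_eq_mul]
    linarith
  · rw [hamiltonField_eq, hamiltonField_eq, ← map_sub]
    refine ((hamiltonMap d).le_opNorm _).trans ?_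
    have h1 := norm_fderiv_gaussianAverage_sub_le (hsmooth t) (hexp t) (hC t) Z W
    have h2 : 0 ≤ ‖hamiltonMap d‖ * averageConst d 1 * ‖gradient (h t) 0‖ * ‖Z - W‖ := by
      positivity
    have h3 := mul_le_mul_of_nonneg_left h1 hJ
    simp only [Pi.add_apply, Pi.smul_apply, smul_eq_mul]
    linarith
  · have h1 : Measurable (Function.uncurry fun (Z : ParamPhase d) t =>
        hamiltonField (gaussianAverage (h t)) Z) :=
      measurable_uncurry_of_continuous_of_measurable
        (fun t => (contDiff_hamiltonField
          (contDiff_gaussianAverage (hsmooth t) (hexp t))).continuous)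
        (measurable_hamiltonField hsmooth hexp hmeas)
    exact (h1.comp (hγ.measurable.prodMk measurable_id)).aestronglyMeasurable

end GaussianWavePacket

namespace GaussianWavePacket

/-! ### Affine change of variables -/

section ChangeOfVariables

variable {ι : Type*} [Fintype ι] [DecidableEq ι]

/-- Affine change of variables in a Lebesgue integral. -/
theorem integral_eq_abs_det_smul_integral {G : Type*} [NormedAddCommGroup G] [NormedSpace ℝ G]
    {A : Matrix ι ι ℝ} (hA : A.det ≠ 0) (c : EuclideanSpace ℝ ι) (g : EuclideanSpace ℝ ι → G) :
    ∫ x, g x = |A.det| • ∫ x : EuclideanSpace ℝ ι, g (WithLp.toLp 2 (A.mulVec x) + c) := by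
  set L : EuclideanSpace ℝ ι →L[ℝ] EuclideanSpace ℝ ι :=
    LinearMap.toContinuousLinearMap (Matrix.toLpLin 2 2 A)
  have hdet : L.det = A.det := by
    change LinearMap.det (Matrix.toLpLin 2 2 A) = _
    rw [Matrix.toLpLin_eq_toLin, LinearMap.det_toLin]
  have hL : ∀ x, L x = WithLp.toLp 2 (A.mulVec x) := fun x => rfl
  have hu : IsUnit A.det := isUnit_iff_ne_zero.2 hA
  have hsurj : Function.Surjective fun x => L x + c := fun y =>
    ⟨WithLp.toLp 2 (A⁻¹.mulVec (y - c)), by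
      simp only [hL, Matrix.mulVec_mulVec, Matrix.mul_nonsing_inv A hu, Matrix.one_mulVec]
      exact sub_add_cancel y c⟩
  have hinj : Function.Injective fun x => L x + c := fun x y hxy => by
    have h1 : A.mulVec x = A.mulVec y := by
      have h2 := add_right_cancel hxy
      rw [hL, hL] at h2
      exact congrArg WithLp.ofLp h2
    have h3 := congrArg (A⁻¹.mulVec ·) h1
    simp only [Matrix.mulVec_mulVec, Matrix.nonsing_inv_mul A hu, Matrix.one_mulVec] at h3
    exact (WithLp.ofLp_injective 2) h3
  have := integral_image_eq_integral_abs_det_fderiv_smul volume MeasurableSet.univ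
    (f := fun x => L x + c) (f' := fun _ => L)
    (fun x _ => (L.hasFDerivAt.add_const c).hasFDerivWithinAt) hinj.injOn g
  rw [Set.image_univ, hsurj.range_eq, setIntegral_univ, setIntegral_univ, integral_smul,
    hdet] at this
  exact this

end ChangeOfVariables

/-! ### Lagrangian frames and the Siegel matrix -/

section LagrangianFrame

variable {n : Type*} [Fintype n] [DecidableEq n]

open Matrix

open scoped ComplexOrder in
-- If `Q v = 0`, the hermitian pairing of `(Qᴴ P - Pᴴ Q) v` with `v` vanishes; it also equals `2i
-- |v|²`, so `v = 0`.
theorem isUnit_det_of_lagrangian {Q P : Matrix n n ℂ}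
    (h2 : Qᴴ * P - Pᴴ * Q = (2 * Complex.I) • (1 : Matrix n n ℂ)) : IsUnit Q.det := by
  rw [isUnit_iff_ne_zero]
  intro h0
  obtain ⟨v, hv, hQv⟩ := Matrix.exists_mulVec_eq_zero_iff.2 h0
  have e1 : star v ⬝ᵥ ((Qᴴ * P - Pᴴ * Q) *ᵥ v) = 0 := by
    rw [sub_mulVec, dotProduct_sub, ← mulVec_mulVec, ← mulVec_mulVec, hQv, dotProduct_mulVec,
      ← star_mulVec, hQv]
    simp
  rw [h2, smul_mulVec, one_mulVec, dotProduct_smul, smul_eq_zero] at e1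
  rcases e1 with e1 | e1
  · simp at e1
  · exact hv (dotProduct_star_self_eq_zero.1 e1)

open scoped MatrixOrder ComplexOrder in
/-- The Siegel matrix `P Q⁻¹` of a normalised Lagrangian frame is symmetric, with imaginary part
`Sᵀ S` for a real matrix `S` such that `S Q` is unitary. -/
theorem exists_siegel_decomposition {Q P : Matrix n n ℂ} (h1 : Qᵀ * P = Pᵀ * Q)
    (h2 : Qᴴ * P - Pᴴ * Q = (2 * Complex.I) • (1 : Matrix n n ℂ)) :
    ∃ A S : Matrix n n ℝ, Aᵀ = A ∧
      P * Q⁻¹ = A.map Complex.ofReal + Complex.I • (Sᵀ * S).map Complex.ofReal ∧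
      (S.map Complex.ofReal * Q)ᴴ * (S.map Complex.ofReal * Q) = 1 := by
  have hQ := isUnit_det_of_lagrangian h2
  have hQ1 := mul_nonsing_inv Q hQ
  have hQt : (Q⁻¹)ᵀ * Qᵀ = 1 := by rw [← transpose_mul, hQ1, transpose_one]
  have hQh : (Q⁻¹)ᴴ * Qᴴ = 1 := by rw [← conjTranspose_mul, hQ1, conjTranspose_one]
  set C := P * Q⁻¹
  have hsymm : Cᵀ = C := by
    calc Cᵀ = (Q⁻¹)ᵀ * (Pᵀ * Q) * Q⁻¹ := by
          rw [transpose_mul, Matrix.mul_assoc, Matrix.mul_assoc, hQ1, Matrix.mul_one]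
      _ = C := by rw [← h1, ← Matrix.mul_assoc, hQt, Matrix.one_mul]
  have him : C - Cᴴ = (2 * Complex.I) • ((Q⁻¹)ᴴ * Q⁻¹) := by
    calc C - Cᴴ = (Q⁻¹)ᴴ * (Qᴴ * P - Pᴴ * Q) * Q⁻¹ := by
          rw [mul_sub, ← Matrix.mul_assoc, hQh, Matrix.one_mul, sub_mul, Matrix.mul_assoc,
            Matrix.mul_assoc, hQ1, Matrix.mul_one, conjTranspose_mul]
      _ = _ := by rw [h2]; simp
  set B : Matrix n n ℝ := Matrix.of fun j k => (C j k).im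
  set A : Matrix n n ℝ := Matrix.of fun j k => (C j k).re
  -- As `C` is symmetric, `Cᴴ` is its entrywise conjugate, so `C - Cᴴ` is `2i` times the entrywise
  -- imaginary part.
  have hB : B.map Complex.ofReal = (Q⁻¹)ᴴ * Q⁻¹ := by
    ext j k
    have e1 := congrFun₂ him j k
    have e2 : Cᴴ j k = (starRingEnd ℂ) (C j k) := by
      conv_rhs => rw [← hsymm]
      rfl
    rw [Matrix.sub_apply, e2, Complex.sub_conj, Matrix.smul_apply, smul_eq_mul] at e1
    have e3 : ((2 * (C j k).im : ℝ) : ℂ) * Complex.I = 2 * Complex.I * ((C j k).im : ℂ) := by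
      push_cast; ring
    rw [e3] at e1
    exact mul_left_cancel₀ (by simp) e1
  have hBs : Bᵀ = B := by
    ext j k
    change (C k j).im = (C j k).im
    conv_rhs => rw [← hsymm]
    rfl
  have hpos : B.PosSemidef := by
    refine PosSemidef.of_dotProduct_mulVec_nonneg
      (by rw [IsHermitian, conjTranspose_eq_transpose_of_trivial, hBs]) fun x => ?_
    have e1 : (((star x ⬝ᵥ (B *ᵥ x) : ℝ)) : ℂ) =
        star (fun i => (x i : ℂ)) ⬝ᵥ (B.map Complex.ofReal *ᵥ fun i => (x i : ℂ)) := by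
      simp [dotProduct, mulVec]
    have e2 := (posSemidef_conjTranspose_mul_self (Q⁻¹)).dotProduct_mulVec_nonneg
      (fun i => (x i : ℂ))
    rw [← hB, ← e1] at e2
    exact_mod_cast e2
  -- A real factor `S` of `Im C` turns the quadratic form into `|S x|²`, and `Qᴴ (Sᵀ S) Q = 1` is
  -- the unitarity of `S Q`.
  obtain ⟨S, hS⟩ := CStarAlgebra.nonneg_iff_eq_star_mul_self.mp hpos.nonneg
  have hS' : B = Sᵀ * S := by
    rw [hS, star_eq_conjTranspose, conjTranspose_eq_transpose_of_trivial]
  refine ⟨A, S, ?_, ?_, ?_⟩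
  · ext j k
    change (C k j).re = (C j k).re
    conv_rhs => rw [← hsymm]
    rfl
  · rw [← hS']
    ext j k
    simp only [Matrix.add_apply, Matrix.smul_apply, Matrix.map_apply, smul_eq_mul]
    rw [mul_comm]
    exact (Complex.re_add_im _).symm
  · have e1 : (S.map Complex.ofReal)ᴴ * S.map Complex.ofReal = B.map Complex.ofReal := by
      rw [hS']
      ext j k
      simp [Matrix.mul_apply]
    rw [conjTranspose_mul, Matrix.mul_assoc, ← Matrix.mul_assoc (S.map Complex.ofReal)ᴴ, e1, hB,
      Matrix.mul_assoc, nonsing_inv_mul Q hQ, Matrix.mul_one, ← conjTranspose_mul,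
      nonsing_inv_mul Q hQ, conjTranspose_one]

end LagrangianFrame

end GaussianWavePacket

namespace GaussianWavePacket

/-! ### From symplectic `Y` to Lagrangian `(Q, P)` -/

variable {d : ℕ}

open Matrix

theorem IsAdmissible.sympEntry {ε : ℝ} {Z : ParamPhase d} (hZ : IsAdmissible ε Z)
    (j k : Fin d ⊕ Fin d) :
    ∑ i : Fin d, (covFactor Z (Sum.inl i) j * covFactor Z (Sum.inr i) k -
      covFactor Z (Sum.inr i) j * covFactor Z (Sum.inl i) k) =
        ε / 2 * structureMatrix (Fin d) j k := by
  have h := congrFun₂ hZ j k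
  rw [sympEntry_eq, Matrix.smul_apply, smul_eq_mul] at h
  simpa only [GaussianWavePacket.sympEntry, covFactor_apply] using h

theorem matQ_apply (ε : ℝ) (Z : ParamPhase d) (i j : Fin d) : matQ ε Z i j =
    (((Real.sqrt (ε / 2))⁻¹ : ℝ) : ℂ) * ((covFactor Z (Sum.inl i) (Sum.inl j) : ℂ) +
      Complex.I * (covFactor Z (Sum.inl i) (Sum.inr j) : ℂ)) := rfl

theorem matP_apply (ε : ℝ) (Z : ParamPhase d) (i j : Fin d) : matP ε Z i j =
    (((Real.sqrt (ε / 2))⁻¹ : ℝ) : ℂ) * ((covFactor Z (Sum.inr i) (Sum.inl j) : ℂ) +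
      Complex.I * (covFactor Z (Sum.inr i) (Sum.inr j) : ℂ)) := rfl

/-- Let `Mᵢⱼ` be the blocks of `Yᵀ Ω Y`. Then `Qᵀ P - Pᵀ Q = M₁₁ - M₂₂ + i (M₁₂ + M₂₁)` and `Qᴴ P -
Pᴴ Q = M₁₁ + M₂₂ + i (M₁₂ - M₂₁)`; the factor `s ^ 2` undoes the scaling by `ε / 2`. -/
theorem IsAdmissible.lagrangian {ε : ℝ} (hε : 0 < ε) {Z : ParamPhase d} (hZ : IsAdmissible ε Z) :
    (matQ ε Z)ᵀ * matP ε Z = (matP ε Z)ᵀ * matQ ε Z ∧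
      (matQ ε Z)ᴴ * matP ε Z - (matP ε Z)ᴴ * matQ ε Z =
        (2 * Complex.I) • (1 : Matrix (Fin d) (Fin d) ℂ) := by
  have key : ∀ j k : Fin d ⊕ Fin d,
      ∑ i : Fin d, ((covFactor Z (Sum.inl i) j : ℂ) * (covFactor Z (Sum.inr i) k : ℂ) -
        (covFactor Z (Sum.inr i) j : ℂ) * (covFactor Z (Sum.inl i) k : ℂ)) =
          ε / 2 * (structureMatrix (Fin d) j k : ℝ) := fun j k => by
    exact_mod_cast hZ.sympEntry j k
  set s : ℂ := (((Real.sqrt (ε / 2))⁻¹ : ℝ) : ℂ)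
  have hs : s ^ 2 * (ε / 2) = 1 := by
    simp only [s]
    norm_cast
    rw [inv_pow, Real.sq_sqrt (by positivity)]
    field_simp
  have hsc : (starRingEnd ℂ) s = s := Complex.conj_ofReal _
  constructor
  · ext j k
    have h := congrArg₂ (· + ·)
      (congrArg₂ (· - ·) (key (Sum.inl j) (Sum.inl k)) (key (Sum.inr j) (Sum.inr k)))
      (congrArg (Complex.I * ·) (congrArg₂ (· + ·) (key (Sum.inl j) (Sum.inr k))
        (key (Sum.inr j) (Sum.inl k))))
    simp only [← Finset.sum_sub_distrib, ← Finset.sum_add_distrib, Finset.mul_sum] at h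
    have h0 := congrArg (s ^ 2 * ·) h
    simp only [Finset.mul_sum] at h0
    rw [← sub_eq_zero, Matrix.mul_apply, Matrix.mul_apply, ← Finset.sum_sub_distrib]
    refine Eq.trans (Finset.sum_congr rfl fun i _ => ?_) (h0.trans ?_)
    · rw [transpose_apply, transpose_apply, matQ_apply, matQ_apply, matP_apply, matP_apply]
      linear_combination s ^ 2 * (covFactor Z (Sum.inl i) (Sum.inr j) *
        covFactor Z (Sum.inr i) (Sum.inr k) - covFactor Z (Sum.inr i) (Sum.inr j) *
        covFactor Z (Sum.inl i) (Sum.inr k)) * Complex.I_sq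
    · simp [structureMatrix]
  · ext j k
    have h := congrArg₂ (· + ·)
      (congrArg₂ (· + ·) (key (Sum.inl j) (Sum.inl k)) (key (Sum.inr j) (Sum.inr k)))
      (congrArg (Complex.I * ·) (congrArg₂ (· - ·) (key (Sum.inl j) (Sum.inr k))
        (key (Sum.inr j) (Sum.inl k))))
    simp only [← Finset.sum_sub_distrib, ← Finset.sum_add_distrib, Finset.mul_sum] at h
    have h0 := congrArg (s ^ 2 * ·) h
    simp only [Finset.mul_sum] at h0
    rw [Matrix.sub_apply, Matrix.mul_apply, Matrix.mul_apply, ← Finset.sum_sub_distrib]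
    refine Eq.trans (Finset.sum_congr rfl fun i _ => ?_) (h0.trans ?_)
    · rw [conjTranspose_apply, conjTranspose_apply, matQ_apply, matQ_apply, matP_apply, matP_apply]
      simp only [star_mul', Complex.star_def, map_add, map_mul, Complex.conj_I, Complex.conj_ofReal]
      linear_combination -s ^ 2 * (covFactor Z (Sum.inl i) (Sum.inr j) *
        covFactor Z (Sum.inr i) (Sum.inr k) - covFactor Z (Sum.inr i) (Sum.inr j) *
        covFactor Z (Sum.inl i) (Sum.inr k)) * Complex.I_sq
    · simp only [structureMatrix, fromBlocks_apply₁₁, fromBlocks_apply₂₂, fromBlocks_apply₁₂,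
        fromBlocks_apply₂₁, Matrix.zero_apply, Matrix.smul_apply, Matrix.neg_apply, smul_eq_mul,
        Matrix.one_apply]
      by_cases hjk : j = k
      · simp only [hjk, if_true]
        push_cast
        linear_combination 2 * Complex.I * hs
      · simp [hjk]

end GaussianWavePacket

namespace GaussianWavePacket

/-! ### Gaussian integrals and products of wave packets -/

variable {d : ℕ}

open Matrix

/-- A Gaussian integral with oscillating factor, for the quadratic form `y ↦ |S y|²`. -/
theorem integral_cexp_quadratic_form {S : Matrix (Fin d) (Fin d) ℝ} (hS : S.det ≠ 0) {ε : ℝ}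
    (hε : 0 < ε) (g : Fin d → ℝ) :
    ∫ y : EuclideanSpace ℝ (Fin d), Complex.exp
      (((-(1 / (4 * ε)) * ((S *ᵥ y) ⬝ᵥ (S *ᵥ y)) : ℝ) : ℂ) +
        Complex.I * ((-((S *ᵥ g) ⬝ᵥ (S *ᵥ y)) / ε : ℝ) : ℂ)) =
      ((|S.det|⁻¹ * (4 * Real.pi * ε) ^ ((d : ℝ) / 2) *
        Real.exp (-((S *ᵥ g) ⬝ᵥ (S *ᵥ g)) / ε) : ℝ) : ℂ) := by
  set b : ℂ := ((1 / (4 * ε) : ℝ) : ℂ)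
  set c : ℂ := -Complex.I / ε
  set G : EuclideanSpace ℝ (Fin d) → ℂ := fun v =>
    Complex.exp (-b * ‖v‖ ^ 2 + c * (inner ℝ (WithLp.toLp 2 (S *ᵥ g)) v : ℝ))
  have hb : 0 < b.re := by simp only [b, Complex.ofReal_re]; positivity
  have h1 := GaussianFourier.integral_cexp_neg_mul_sq_norm_add hb c
    (WithLp.toLp 2 (S *ᵥ g) : EuclideanSpace ℝ (Fin d))
  have hn : ∀ x : Fin d → ℝ, ‖(WithLp.toLp 2 x : EuclideanSpace ℝ (Fin d))‖ ^ 2 = x ⬝ᵥ x :=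
    fun x => by rw [EuclideanSpace.real_norm_sq_eq]; simp [dotProduct, sq]
  have hi : ∀ x y : Fin d → ℝ, inner ℝ (WithLp.toLp 2 x : EuclideanSpace ℝ (Fin d))
      (WithLp.toLp 2 y) = x ⬝ᵥ y := fun x y => by
    simp [PiLp.inner_apply, dotProduct, mul_comm]
  have h2 := integral_eq_abs_det_smul_integral hS 0 G
  have h3 : ∀ y : EuclideanSpace ℝ (Fin d), G (WithLp.toLp 2 (S *ᵥ y) + 0) = Complex.exp
      (((-(1 / (4 * ε)) * ((S *ᵥ y) ⬝ᵥ (S *ᵥ y)) : ℝ) : ℂ) +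
        Complex.I * ((-((S *ᵥ g) ⬝ᵥ (S *ᵥ y)) / ε : ℝ) : ℂ)) := fun y => by
    simp only [G, add_zero, hi, ← Complex.ofReal_pow, hn, b, c]
    congr 1
    push_cast
    ring
  simp only [h3] at h2
  have hdet : |S.det| ≠ 0 := abs_ne_zero.2 hS
  rw [← inv_smul_smul₀ hdet (∫ y : EuclideanSpace ℝ (Fin d), Complex.exp _), ← h2, h1,
    ← Complex.ofReal_pow, hn, finrank_euclideanSpace, Fintype.card_fin, Complex.real_smul]
  have h4 : ((Real.pi : ℂ) / b) ^ ((d : ℂ) / 2) = (((4 * Real.pi * ε) ^ ((d : ℝ) / 2) : ℝ) : ℂ) := by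
    rw [Complex.ofReal_cpow (by positivity)]
    congr 1
    · simp only [b]; push_cast; field_simp
    · push_cast; rfl
  have h5 : c ^ 2 * (((S *ᵥ g) ⬝ᵥ (S *ᵥ g) : ℝ) : ℂ) / (4 * b) =
      ((-((S *ᵥ g) ⬝ᵥ (S *ᵥ g)) / ε : ℝ) : ℂ) := by
    have : (ε : ℂ) ≠ 0 := by exact_mod_cast hε.ne'
    simp only [b, c, div_pow, neg_sq, Complex.I_sq]
    push_cast
    field_simp
  rw [h4, h5, ← Complex.ofReal_exp]
  push_cast
  ring

/-- In the product of a conjugated packet with a packet the phase `S` cancels, the imaginary parts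
`β` of the quadratic forms add up to the decay, and the real parts `α` and `l` subtract in the
phase. -/
theorem conj_cexp_mul_cexp (c : ℂ) (ε S α₁ β₁ l₁ α₂ β₂ l₂ θ : ℝ) :
    (starRingEnd ℂ) (c * Complex.exp (Complex.I / (ε : ℂ) *
        (1 / 2 * ((α₁ : ℂ) + Complex.I * (β₁ : ℂ)) + (l₁ : ℂ) + (S : ℂ)))) *
      (c * Complex.exp (Complex.I / (ε : ℂ) *
        (1 / 2 * ((α₂ : ℂ) + Complex.I * (β₂ : ℂ)) + (l₂ : ℂ) + (S : ℂ)))) *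
      Complex.exp (Complex.I * ((θ / ε : ℝ) : ℂ)) =
    ((‖c‖ ^ 2 : ℝ) : ℂ) * Complex.exp (((-(β₁ + β₂) / (2 * ε) : ℝ) : ℂ) +
      Complex.I * (((1 / 2 * (α₂ - α₁) + l₂ - l₁ + θ) / ε : ℝ) : ℂ)) := by
  rw [map_mul, ← Complex.exp_conj]
  have h1 : ((‖c‖ ^ 2 : ℝ) : ℂ) = (starRingEnd ℂ) c * c := by
    rw [mul_comm, Complex.mul_conj, Complex.normSq_eq_norm_sq]
  have h2 : ∀ A B D : ℂ, (starRingEnd ℂ) c * Complex.exp A * (c * Complex.exp B) * Complex.exp D =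
      (starRingEnd ℂ) c * c * Complex.exp (A + B + D) := fun A B D => by
    rw [Complex.exp_add, Complex.exp_add]; ring
  rw [h2, h1]
  congr 2
  simp only [map_mul, map_div₀, map_add, Complex.conj_I, Complex.conj_ofReal, map_one,
    map_ofNat]
  push_cast
  linear_combination ((β₁ : ℂ) + β₂) / (2 * ε) * Complex.I_sq

/-- The value of a wave packet in terms of the decomposition of its Siegel matrix. -/
theorem wavePacket_eq {ε : ℝ} {Z : ParamPhase d} {A S : Matrix (Fin d) (Fin d) ℝ}
    (hC : matP ε Z * (matQ ε Z)⁻¹ =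
      A.map Complex.ofReal + Complex.I • (Sᵀ * S).map Complex.ofReal) (S₀ : ℝ)
    {x : EuclideanSpace ℝ (Fin d)} {X : Fin d → ℝ} (hX : ∀ j, x j - posCentre Z j = X j) :
    wavePacket ε S₀ Z x =
      (((ε * Real.pi) ^ (-(d : ℝ) / 4) : ℝ) : ℂ) / ((matQ ε Z).det ^ (1 / 2 : ℂ)) *
      Complex.exp (Complex.I / (ε : ℂ) * (1 / 2 * (((X ⬝ᵥ A *ᵥ X : ℝ) : ℂ) +
        Complex.I * (((S *ᵥ X) ⬝ᵥ (S *ᵥ X) : ℝ) : ℂ)) +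
        (((momCentre Z).ofLp ⬝ᵥ X : ℝ) : ℂ) + (S₀ : ℂ))) := by
  simp only [wavePacket, hX]
  congr 4
  · congr 1
    · congr 1
      rw [hC, add_mulVec, dotProduct_add, smul_mulVec, dotProduct_smul, smul_eq_mul]
      have h1 : (S *ᵥ X) ⬝ᵥ (S *ᵥ X) = X ⬝ᵥ (Sᵀ * S) *ᵥ X := by
        rw [← mulVec_mulVec, dotProduct_mulVec X, vecMul_transpose]
      rw [h1]
      simp [dotProduct, mulVec]
    · simp [dotProduct]

end GaussianWavePacket

namespace GaussianWavePacket

/-! ### The Wigner function of a wave packet -/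

variable {d : ℕ}

open Matrix

/-- The vector `√(ε/2) (a - i b)` in `ℂ^d` associated with `(a, b)` in `ℝ^{2d}`. -/
noncomputable def complexCoord (ε : ℝ) (ζ : Fin d ⊕ Fin d → ℝ) : Fin d → ℂ := fun j =>
  ((Real.sqrt (ε / 2) : ℝ) : ℂ) * ((ζ (Sum.inl j) : ℂ) - Complex.I * (ζ (Sum.inr j) : ℂ))

theorem inv_sqrt_mul_mul_sqrt {ε : ℝ} (hε : 0 < ε) (a b x y : ℝ) :
    ((((Real.sqrt (ε / 2))⁻¹ : ℝ) : ℂ) * ((a : ℂ) + Complex.I * (b : ℂ)) *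
      (((Real.sqrt (ε / 2) : ℝ) : ℂ) * ((x : ℂ) - Complex.I * (y : ℂ)))).re = a * x + b * y := by
  have h : (((Real.sqrt (ε / 2))⁻¹ : ℝ) : ℂ) * ((Real.sqrt (ε / 2) : ℝ) : ℂ) = 1 := by
    rw [← Complex.ofReal_mul, inv_mul_cancel₀ (by positivity), Complex.ofReal_one]
  rw [mul_mul_mul_comm, h, one_mul]
  simp

theorem re_matQ_mulVec {ε : ℝ} (hε : 0 < ε) (Z : ParamPhase d) (ζ : Fin d ⊕ Fin d → ℝ)
    (i : Fin d) : ((matQ ε Z *ᵥ complexCoord ε ζ) i).re = (covFactor Z *ᵥ ζ) (Sum.inl i) := by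
  simp only [mulVec, dotProduct, Complex.re_sum, matQ_apply, complexCoord,
    inv_sqrt_mul_mul_sqrt hε, Fintype.sum_sum_type, Finset.sum_add_distrib]

theorem re_matP_mulVec {ε : ℝ} (hε : 0 < ε) (Z : ParamPhase d) (ζ : Fin d ⊕ Fin d → ℝ)
    (i : Fin d) : ((matP ε Z *ᵥ complexCoord ε ζ) i).re = (covFactor Z *ᵥ ζ) (Sum.inr i) := by
  simp only [mulVec, dotProduct, Complex.re_sum, matP_apply, complexCoord,
    inv_sqrt_mul_mul_sqrt hε, Fintype.sum_sum_type, Finset.sum_add_distrib]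

theorem star_complexCoord_dotProduct {ε : ℝ} (hε : 0 < ε) (ζ : ClassicalPhase d) :
    star (complexCoord ε ζ) ⬝ᵥ complexCoord ε ζ = ((ε / 2 * ‖ζ‖ ^ 2 : ℝ) : ℂ) := by
  have hs : ((Real.sqrt (ε / 2) : ℝ) : ℂ) * ((Real.sqrt (ε / 2) : ℝ) : ℂ) = ((ε / 2 : ℝ) : ℂ) := by
    rw [← Complex.ofReal_mul, Real.mul_self_sqrt (by positivity)]
  rw [EuclideanSpace.real_norm_sq_eq, Fintype.sum_sum_type, ← Finset.sum_add_distrib,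
    Finset.mul_sum, Complex.ofReal_sum]
  refine Finset.sum_congr rfl fun j _ => ?_
  simp only [complexCoord, Pi.star_apply, star_mul', Complex.star_def, map_sub, map_mul,
    Complex.conj_ofReal, Complex.conj_I]
  rw [mul_mul_mul_comm, hs]
  push_cast
  linear_combination -(ε / 2 : ℂ) * (ζ.ofLp (Sum.inr j) : ℂ) ^ 2 * Complex.I_sq

theorem star_mulVec_dotProduct_of_isometry {n : Type*} [Fintype n] [DecidableEq n]
    {U : Matrix n n ℂ} (hU : Uᴴ * U = 1) (v : n → ℂ) :
    star (U *ᵥ v) ⬝ᵥ (U *ᵥ v) = star v ⬝ᵥ v := by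
  rw [star_mulVec, ← dotProduct_mulVec, mulVec_mulVec, hU, one_mulVec]

theorem star_map_ofReal_mulVec (S : Matrix (Fin d) (Fin d) ℝ) (f : Fin d → ℂ) :
    star (S.map Complex.ofReal *ᵥ f) ⬝ᵥ (S.map Complex.ofReal *ᵥ f) =
      (((S *ᵥ fun i => (f i).re) ⬝ᵥ (S *ᵥ fun i => (f i).re) +
        (S *ᵥ fun i => (f i).im) ⬝ᵥ (S *ᵥ fun i => (f i).im) : ℝ) : ℂ) := by
  have h : ∀ i, (S.map Complex.ofReal *ᵥ f) i =
      ((S *ᵥ fun i => (f i).re) i : ℂ) + ((S *ᵥ fun i => (f i).im) i : ℂ) * Complex.I :=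
    fun i => by
      simp only [mulVec, dotProduct, map_apply, Complex.ofReal_sum, Complex.ofReal_mul,
        Finset.sum_mul, ← Finset.sum_add_distrib]
      refine Finset.sum_congr rfl fun j _ => ?_
      conv_lhs => rw [← Complex.re_add_im (f j)]
      ring
  simp only [dotProduct, Pi.star_apply, h, Complex.star_def, map_add, map_mul, Complex.conj_I,
    Complex.conj_ofReal, ← Finset.sum_add_distrib, Complex.ofReal_sum]
  refine Finset.sum_congr rfl fun i _ => ?_
  push_cast
  linear_combination -((S *ᵥ fun i => (f i).im) i : ℂ) ^ 2 * Complex.I_sq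

/-- The determinant of the unitary matrix `S Q` has modulus `1`. -/
theorem abs_det_mul_norm_det {Q : Matrix (Fin d) (Fin d) ℂ} {S : Matrix (Fin d) (Fin d) ℝ}
    (hU : (S.map Complex.ofReal * Q)ᴴ * (S.map Complex.ofReal * Q) = 1) :
    |S.det| * ‖Q.det‖ = 1 := by
  have h1 := congrArg (fun M : Matrix (Fin d) (Fin d) ℂ => ‖M.det‖) hU
  have h2 : (S.map Complex.ofReal).det = (S.det : ℂ) :=
    (RingHom.map_det Complex.ofRealHom S).symm
  simp only [det_mul, det_conjTranspose, norm_mul, norm_star, det_one, norm_one, h2,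
    Complex.norm_real, Real.norm_eq_abs] at h1
  nlinarith [mul_nonneg (abs_nonneg S.det) (norm_nonneg Q.det)]

/-- In the exponent of the Wigner integrand `p` and `A w` cancel against the same terms of `ξ = p +
A w - Sᵀ S g`; only the frequency `-Sᵀ S g` remains. -/
theorem wigner_phase {A S : Matrix (Fin d) (Fin d) ℝ} (hA : Aᵀ = A) (p w g y : Fin d → ℝ) :
    1 / 2 * ((w - (1 / 2 : ℝ) • y) ⬝ᵥ A *ᵥ (w - (1 / 2 : ℝ) • y) -
      (w + (1 / 2 : ℝ) • y) ⬝ᵥ A *ᵥ (w + (1 / 2 : ℝ) • y)) + p ⬝ᵥ (w - (1 / 2 : ℝ) • y) -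
      p ⬝ᵥ (w + (1 / 2 : ℝ) • y) + (p + A *ᵥ w - (Sᵀ * S) *ᵥ g) ⬝ᵥ y =
      -((S *ᵥ g) ⬝ᵥ (S *ᵥ y)) := by
  have h1 : y ⬝ᵥ A *ᵥ w = w ⬝ᵥ A *ᵥ y := by
    rw [dotProduct_mulVec w, ← mulVec_transpose, hA, dotProduct_comm]
  have h2 : (A *ᵥ w) ⬝ᵥ y = w ⬝ᵥ A *ᵥ y := by rw [dotProduct_comm, h1]
  have h3 : ((Sᵀ * S) *ᵥ g) ⬝ᵥ y = (S *ᵥ g) ⬝ᵥ (S *ᵥ y) := by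
    rw [← mulVec_mulVec, mulVec_transpose, ← dotProduct_mulVec]
  simp only [mulVec_add, mulVec_sub, mulVec_smul, dotProduct_add, dotProduct_sub, add_dotProduct,
    sub_dotProduct, smul_dotProduct, dotProduct_smul, smul_eq_mul, h1, h2, h3]
  ring

/-- The parallelogram law separates the decay in `w` from that in `y`. -/
theorem wigner_modulus (S : Matrix (Fin d) (Fin d) ℝ) (w y : Fin d → ℝ) :
    (S *ᵥ (w + (1 / 2 : ℝ) • y)) ⬝ᵥ (S *ᵥ (w + (1 / 2 : ℝ) • y)) +
      (S *ᵥ (w - (1 / 2 : ℝ) • y)) ⬝ᵥ (S *ᵥ (w - (1 / 2 : ℝ) • y)) =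
      2 * ((S *ᵥ w) ⬝ᵥ (S *ᵥ w)) + 1 / 2 * ((S *ᵥ y) ⬝ᵥ (S *ᵥ y)) := by
  simp only [mulVec_add, mulVec_sub, mulVec_smul, dotProduct_add, dotProduct_sub, add_dotProduct,
    sub_dotProduct, smul_dotProduct, dotProduct_smul, smul_eq_mul]
  ring

/-- Here `D` and `q` are `|det S|` and `det Q`. The branch of the square root is immaterial, as only
`|q ^ (1/2)|² = |q|` enters, and `|q|` cancels against the Jacobian `D⁻¹`. -/
theorem wavePacket_constant {ε D : ℝ} (hε : 0 < ε) (hD : 0 < D) {q : ℂ} (h : D * ‖q‖ = 1) (d : ℕ) :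
    ((2 * Real.pi * ε) ^ d)⁻¹ *
      (‖(((ε * Real.pi) ^ (-(d : ℝ) / 4) : ℝ) : ℂ) / (q ^ (1 / 2 : ℂ))‖ ^ 2 *
        (D⁻¹ * (4 * Real.pi * ε) ^ ((d : ℝ) / 2))) = ((Real.pi * ε) ^ d)⁻¹ := by
  have hq : 0 < ‖q‖ := pos_of_mul_pos_right (h ▸ one_pos) hD.le
  have h0 : ‖q ^ (1 / 2 : ℂ)‖ ^ 2 = ‖q‖ := by
    have := Complex.norm_cpow_of_ne_zero (norm_pos_iff.1 hq) (1 / 2 : ℂ)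
    rw [this]
    have e : (1 / 2 : ℂ) = ((1 / 2 : ℝ) : ℂ) := by push_cast; rfl
    rw [e, Complex.ofReal_re, Complex.ofReal_im, mul_zero, Real.exp_zero, div_one,
      ← Real.rpow_natCast, ← Real.rpow_mul hq.le]
    norm_num
  have hp : 0 < Real.pi * ε := by positivity
  rw [norm_div, div_pow, h0, Complex.norm_real, Real.norm_eq_abs, sq_abs,
    ← Real.rpow_natCast (_ ^ (_ / 4)) 2, ← Real.rpow_mul (by positivity)]
  have e1 : (ε * Real.pi) ^ (-(d : ℝ) / 4 * (2 : ℕ)) = ((Real.pi * ε) ^ ((d : ℝ) / 2))⁻¹ := by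
    rw [← Real.rpow_neg hp.le, mul_comm ε]
    congr 1
    push_cast
    ring
  have e2 : (4 * Real.pi * ε) ^ ((d : ℝ) / 2) = 2 ^ d * (Real.pi * ε) ^ ((d : ℝ) / 2) := by
    rw [mul_assoc, Real.mul_rpow (by norm_num) hp.le]
    congr 1
    rw [show (4 : ℝ) = 2 ^ (2 : ℝ) by norm_num, ← Real.rpow_mul (by norm_num),
      ← Real.rpow_natCast]
    congr 1
    ring
  have hr : 0 < (Real.pi * ε) ^ ((d : ℝ) / 2) := Real.rpow_pos_of_pos hp _
  have hD' : D⁻¹ = ‖q‖ := inv_eq_of_mul_eq_one_right h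
  rw [e1, e2, hD', mul_assoc 2, mul_pow]
  field_simp

/-- The Wigner function of a Gaussian wave packet is a Gaussian. -/
theorem wigner_wavePacket {ε : ℝ} (hε : 0 < ε) {Z : ParamPhase d} (hZ : IsAdmissible ε Z)
    (S₀ : ℝ) (ζ : ClassicalPhase d) :
    wigner ε (wavePacket ε S₀ Z) (WithLp.toLp 2 (covFactor Z *ᵥ ζ) + centre Z) =
      ((((Real.pi * ε) ^ d)⁻¹ * Real.exp (-(1 / 2) * ‖ζ‖ ^ 2) : ℝ) : ℂ) := by
  obtain ⟨hL1, hL2⟩ := hZ.lagrangian hε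
  obtain ⟨A, S, hA, hC, hU⟩ := exists_siegel_decomposition hL1 hL2
  have hQ := isUnit_det_of_lagrangian hL2
  have hdet := abs_det_mul_norm_det hU
  have hS : S.det ≠ 0 := fun h => by simp [h] at hdet
  -- For the phase space point `(x, ξ) = Y_ε ζ + z`, the vector `f = w + i g` has `w = x - q`, and
  -- the real part of `P Q⁻¹ f = (A + i Sᵀ S)(w + i g)` is `ξ - p`.
  set f : Fin d → ℂ := matQ ε Z *ᵥ complexCoord ε ζ with hf
  set w : Fin d → ℝ := fun i => (f i).re with hw
  set g : Fin d → ℝ := fun i => (f i).im with hg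
  have hx : ∀ i, (covFactor Z *ᵥ ζ) (Sum.inl i) = w i := fun i =>
    (re_matQ_mulVec hε Z ζ i).symm
  have hξ : ∀ i, (covFactor Z *ᵥ ζ) (Sum.inr i) = (A *ᵥ w - (Sᵀ * S) *ᵥ g) i := fun i => by
    rw [← re_matP_mulVec hε]
    have : matP ε Z *ᵥ complexCoord ε ζ = (matP ε Z * (matQ ε Z)⁻¹) *ᵥ f := by
      rw [hf, mulVec_mulVec, Matrix.mul_assoc, nonsing_inv_mul _ hQ, Matrix.mul_one]
    rw [this, hC, add_mulVec, smul_mulVec]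
    simp [mulVec, dotProduct, hw, hg, Matrix.map_apply, sub_eq_add_neg]
  -- Unitarity of `S Q` makes `|S f|²` equal to the squared norm of `complexCoord ε ζ`.
  have hnorm : (S *ᵥ w) ⬝ᵥ (S *ᵥ w) + (S *ᵥ g) ⬝ᵥ (S *ᵥ g) = ε / 2 * ‖ζ‖ ^ 2 := by
    have h1 := star_mulVec_dotProduct_of_isometry hU (complexCoord ε ζ)
    rw [← mulVec_mulVec, star_map_ofReal_mulVec, star_complexCoord_dotProduct hε] at h1
    exact_mod_cast h1
  set p : Fin d → ℝ := (momCentre Z).ofLp with hp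
  set c : ℂ := (((ε * Real.pi) ^ (-(d : ℝ) / 4) : ℝ) : ℂ) / ((matQ ε Z).det ^ (1 / 2 : ℂ)) with hc
  have key : ∀ y : EuclideanSpace ℝ (Fin d),
      (starRingEnd ℂ) (wavePacket ε S₀ Z ((WithLp.toLp 2 fun j =>
        (WithLp.toLp 2 (covFactor Z *ᵥ ζ) + centre Z : ClassicalPhase d) (Sum.inl j)) +
          (1 / 2 : ℝ) • y)) *
        wavePacket ε S₀ Z ((WithLp.toLp 2 fun j =>
        (WithLp.toLp 2 (covFactor Z *ᵥ ζ) + centre Z : ClassicalPhase d) (Sum.inl j)) -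
          (1 / 2 : ℝ) • y) *
        Complex.exp (Complex.I * ((inner ℝ (WithLp.toLp 2 fun j =>
          (WithLp.toLp 2 (covFactor Z *ᵥ ζ) + centre Z : ClassicalPhase d) (Sum.inr j) :
            EuclideanSpace ℝ (Fin d)) y / ε : ℝ) : ℂ)) =
      ((‖c‖ ^ 2 * Real.exp (-((S *ᵥ w) ⬝ᵥ (S *ᵥ w)) / ε) : ℝ) : ℂ) * Complex.exp
      (((-(1 / (4 * ε)) * ((S *ᵥ y) ⬝ᵥ (S *ᵥ y)) : ℝ) : ℂ) +
        Complex.I * ((-((S *ᵥ g) ⬝ᵥ (S *ᵥ y)) / ε : ℝ) : ℂ)) := fun y => by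
    rw [wavePacket_eq hC S₀ (X := w + (1 / 2 : ℝ) • y.ofLp)
        (fun j => by simp [centre, hx]; ring),
      wavePacket_eq hC S₀ (X := w - (1 / 2 : ℝ) • y.ofLp)
        (fun j => by simp [centre, hx]; ring)]
    rw [conj_cexp_mul_cexp, wigner_modulus]
    have hin : inner ℝ (WithLp.toLp 2 fun j =>
          (WithLp.toLp 2 (covFactor Z *ᵥ ζ) + centre Z : ClassicalPhase d) (Sum.inr j) :
            EuclideanSpace ℝ (Fin d)) y = (p + A *ᵥ w - (Sᵀ * S) *ᵥ g) ⬝ᵥ y.ofLp := by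
      rw [PiLp.inner_apply, dotProduct]
      refine Finset.sum_congr rfl fun j _ => ?_
      simp only [centre, PiLp.add_apply, hξ, Sum.elim_inr, hp, Pi.add_apply, Pi.sub_apply,
        RCLike.inner_apply, conj_trivial]
      ring
    rw [hin, wigner_phase hA, Complex.ofReal_mul, Complex.ofReal_exp, mul_assoc (_ : ℂ),
      ← Complex.exp_add, ← add_assoc, ← Complex.ofReal_add]
    congr 5
    field_simp
    ring
  simp only [wigner]
  simp only [key]
  rw [integral_const_mul, integral_cexp_quadratic_form hS hε, ← Complex.ofReal_inv,
    ← Complex.ofReal_mul, ← Complex.ofReal_mul]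
  congr 1
  rw [← wavePacket_constant hε (abs_pos.2 hS) hdet d, ← hc]
  -- The factor with `w` is the modulus of the packets, the one with `g` comes from the Fourier
  -- integral in `y`; `hnorm` merges them into the standard Gaussian.
  have he : Real.exp (-(1 / 2) * ‖ζ‖ ^ 2) = Real.exp (-((S *ᵥ w) ⬝ᵥ (S *ᵥ w)) / ε) *
      Real.exp (-((S *ᵥ g) ⬝ᵥ (S *ᵥ g)) / ε) := by
    rw [← Real.exp_add, ← add_div, ← neg_add, hnorm]
    congr 1
    field_simp
  rw [he]
  ring

/-- Determinants of the `2d × 2d` identity `Yᵀ Ω Y = (ε/2) Ω` give `det² = (ε/2)^{2d}`, since `Ω² =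
-1` makes `Ω` invertible. -/
theorem IsAdmissible.abs_det_covFactor {ε : ℝ} (hε : 0 < ε) {Z : ParamPhase d}
    (hZ : IsAdmissible ε Z) : |(covFactor Z).det| = (ε / 2) ^ d := by
  have hJ : (structureMatrix (Fin d)).det ≠ 0 := by
    have h : structureMatrix (Fin d) * structureMatrix (Fin d) = -1 := by
      rw [structureMatrix, fromBlocks_multiply, ← fromBlocks_one, fromBlocks_neg]
      simp
    intro h0
    have h1 := congrArg det h
    rw [det_mul, h0, zero_mul, det_neg, det_one] at h1
    simp at h1
  have h := congrArg det hZ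
  rw [det_mul, det_mul, det_transpose, det_smul, Fintype.card_sum, Fintype.card_fin] at h
  have h2 : (covFactor Z).det ^ 2 = ((ε / 2) ^ d) ^ 2 :=
    mul_right_cancel₀ hJ (by rw [← pow_mul, mul_two, ← h]; ring)
  rw [← abs_of_pos (by positivity : 0 < (ε / 2) ^ d)]
  exact (sq_eq_sq_iff_abs_eq_abs _ _).1 h2

/-- The Gaussian average is the expectation value with respect to the Wigner function of the
wave packet. -/
theorem gaussianAverage_eq_integral_wigner {ε : ℝ} (hε : 0 < ε) (a : ClassicalPhase d → ℝ) (S : ℝ)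
    {Z : ParamPhase d} (hZ : IsAdmissible ε Z) :
    (gaussianAverage a Z : ℂ) = ∫ ζ, (a ζ : ℂ) * wigner ε (wavePacket ε S Z) ζ := by
  have hdet := hZ.abs_det_covFactor hε
  have hne : (covFactor Z).det ≠ 0 := abs_ne_zero.1 (hdet ▸ by positivity)
  -- The substitution `Y_ε ζ + z` has Jacobian `(ε/2)^d`, which turns `(πε)^{-d}` into the
  -- normalisation `(2π)^{-d}`.
  rw [integral_eq_abs_det_smul_integral hne (centre Z), hdet]
  have h : ∀ ζ : ClassicalPhase d, (a (WithLp.toLp 2 (covFactor Z *ᵥ ζ) + centre Z) : ℂ) *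
      wigner ε (wavePacket ε S Z) (WithLp.toLp 2 (covFactor Z *ᵥ ζ) + centre Z) =
      ((((Real.pi * ε) ^ d)⁻¹ * averageIntegrand a Z ζ : ℝ) : ℂ) := fun ζ => by
    rw [wigner_wavePacket hε hZ, averageIntegrand, ← Complex.ofReal_mul]
    congr 1
    ring
  simp only [h]
  rw [integral_complex_ofReal, integral_const_mul, Complex.real_smul, ← Complex.ofReal_mul,
    gaussianAverage, ← mul_assoc]
  congr 2
  rw [div_pow, mul_pow, mul_pow]
  field_simp

end GaussianWavePacket
theorem mainTheorem7 (d : ℕ) (ε : ℝ) (hε : 0 < ε)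
    (h : ℝ → GaussianWavePacket.ClassicalPhase d → ℝ)
    (hsmooth : ∀ t, ContDiff ℝ ∞ (h t))
    (hexp : ∀ t, GaussianWavePacket.ExponentialGrowth (h t)) :
    -- the averaged Hamiltonian is well defined and smooth on the parameter phase space
    (∀ t, (∀ Z, Integrable (GaussianWavePacket.averageIntegrand (h t) Z)) ∧
      ContDiff ℝ ∞ (GaussianWavePacket.gaussianAverage (h t))) ∧
    -- on wave packet parameters it is the average of the symbol in the wave packet
    (∀ (t S : ℝ) (Z : GaussianWavePacket.ParamPhase d), GaussianWavePacket.IsAdmissible ε Z →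
      (GaussianWavePacket.gaussianAverage (h t) Z : ℂ) =
        ∫ ζ, (h t ζ : ℂ) *
          GaussianWavePacket.wigner ε (GaussianWavePacket.wavePacket ε S Z) ζ) ∧
    -- coercivity is inherited
    (∀ t, GaussianWavePacket.Coercive (h t) →
      GaussianWavePacket.Coercive (GaussianWavePacket.gaussianAverage (h t))) ∧
    -- subquadratic growth is inherited
    (GaussianWavePacket.Subquadratic h →
      GaussianWavePacket.Subquadratic fun t => GaussianWavePacket.gaussianAverage (h t)) ∧
    -- global well-posedness for subquadratic symbols
    (GaussianWavePacket.Subquadratic h → (∀ z, Measurable fun t => h t z) →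
      LocallyIntegrable (fun t => gradient (h t) 0) volume →
      GaussianWavePacket.GloballyWellPosed (fun t =>
        GaussianWavePacket.hamiltonField (GaussianWavePacket.gaussianAverage (h t))) ∧
      GaussianWavePacket.PreservesWavePackets ε (fun t =>
        GaussianWavePacket.hamiltonField (GaussianWavePacket.gaussianAverage (h t)))) ∧
    -- global well-posedness for time-independent coercive symbols
    ((∀ s t, h s = h t) → (∀ t, GaussianWavePacket.Coercive (h t)) →
      GaussianWavePacket.GloballyWellPosed (fun t =>
        GaussianWavePacket.hamiltonField (GaussianWavePacket.gaussianAverage (h t))) ∧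
      GaussianWavePacket.PreservesWavePackets ε (fun t =>
        GaussianWavePacket.hamiltonField (GaussianWavePacket.gaussianAverage (h t)))) := by
  refine ⟨fun t => ⟨GaussianWavePacket.integrable_averageIntegrand (hsmooth t) (hexp t),
      GaussianWavePacket.contDiff_gaussianAverage (hsmooth t) (hexp t)⟩,
    fun t S Z hZ => GaussianWavePacket.gaussianAverage_eq_integral_wigner hε (h t) S hZ,
    fun t => GaussianWavePacket.coercive_gaussianAverage (hsmooth t) (hexp t),
    GaussianWavePacket.subquadratic_gaussianAverage hsmooth hexp,
    fun hsub hmeas hgrad =>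
      ⟨GaussianWavePacket.globallyWellPosed_of_subquadratic hsmooth hexp hsub hmeas hgrad,
        GaussianWavePacket.preservesWavePackets ε hsmooth hexp⟩,
    fun hconst hco => ⟨?_, GaussianWavePacket.preservesWavePackets ε hsmooth hexp⟩⟩
  rw [show h = fun _ => h 0 from funext fun t => hconst t 0]
  exact GaussianWavePacket.globallyWellPosed_of_coercive_symbol (hsmooth 0) (hexp 0) (hco 0)
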